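/- **Notation.** Let $d\ge 0$ be an integer. For $n\in\{d,2d\}$ let $\gamma(t)=2^{n/4}e^{-\pi |t|^2}$ on $\mathbb{R}^n$, $\pi(x,\omega)f(t)=e^{2\pi i\omega\cdot t}f(t-x)$, and $V_\gamma u(x,\omega)=\langle u,\pi(x,\omega)\gamma\rangle$ for $u\in\mathcal{S}'(\mathbb{R}^n)$, where $\langle\cdot,\cdot\rangle$ extends $\int f\overline g$. For $p\in\{1,\infty\}$ let $M^p(\mathbb{R}^n)=\{u\in\mathcal{S}'(\mathbb{R}^n): V_\gamma u\in L^p(\mathbb{R}^{2n})\}$; recall that $M^1(\mathbb{R}^n)\subset L^2(\mathbb{R}^n)$. The bracket is extended to $M^\infty(\mathbb{R}^n)\times M^1(\mathbb{R}^n)$ by $\langle u,F\rangle=\int_{\mathbb{R}^{2n}}V_\gamma u(z)\,\overline{V_\gamma F(z)}\,dz$. For a function $F$ on $\mathbb{R}^{2d}$ put $\mathcal{F}_2F(x,\omega)=\int_{\mathbb{R}^d}e^{-2\pi i\omega\cdot y}F(x,y)\,dy$ and, for $A\in \mathrm{GL}(2d,\mathbb{R})$, $\mathfrak{T}_AF(z)=F(Az)$.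 Both are extended to $\mathcal{S}'(\mathbb{R}^{2d})$ by duality, that is $\langle\mathcal{F}_2u,\varphi\rangle=\langle u,\mathcal{F}_2^{-1}\varphi\rangle$ and $\langle\mathfrak{T}_Au,\varphi\rangle=|\det A|^{-1}\langle u,\mathfrak{T}_{A^{-1}}\varphi\rangle$ for $\varphi\in\mathcal{S}(\mathbb{R}^{2d})$. For $f,g\in M^1(\mathbb{R}^d)$ let $\mathcal{B}_A(f,g)=\mathcal{F}_2\mathfrak{T}_A(f\otimes\overline g)$, i.e., writing $A$ in $d\times d$ blocks $A_{ij}$, $$\mathcal{B}_A(f,g)(x,\omega)=\int_{\mathbb{R}^d}e^{-2\pi i\omega\cdot y}f(A_{11}x+A_{12}y)\,\overline{g(A_{21}x+A_{22}y)}\,dy .$$ **Proposition.** Let $A,B\in\mathrm{GL}(2d,\mathbb{R})$ and $\sigma,\rho\in M^\infty(\mathbb{R}^{2d})$. For every $f\in M^1(\mathbb{R}^d)$ there is exactly one $\sigma^Af\in M^\infty(\mathbb{R}^d)$ with $$\langle\sigma^Af,g\rangle=\langle\sigma,\mathcal{B}_A(g,f)\rangle\qquad\text{for all }g\in M^1(\mathbb{R}^d),$$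 and likewise exactly one $\rho^Bf\in M^\infty(\mathbb{R}^d)$ with $\langle\rho^Bf,g\rangle=\langle\rho,\mathcal{B}_B(g,f)\rangle$ for all $g\in M^1(\mathbb{R}^d)$. The resulting maps $\sigma^A,\rho^B:M^1(\mathbb{R}^d)\to M^\infty(\mathbb{R}^d)$ satisfy $$\sigma^A=\rho^B\quad\Longleftrightarrow\quad\sigma=\frac{|\det A|}{|\det B|}\,\mathcal{F}_2\,\mathfrak{T}_{B^{-1}A}\,\mathcal{F}_2^{-1}\rho .$$ -/

import Mathlib

open MeasureTheory
open scoped SchwartzMap FourierTransform ENNReal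

noncomputable section

namespace MatrixWigner

/-- `ℝⁿ` with coordinates indexed by `ι`. -/
abbrev Euc (ι : Type) [Fintype ι] : Type := EuclideanSpace ℝ ι

/-- `ℝ²ᵈ`, with points `(x, y)`, `x, y ∈ ℝᵈ`. -/
abbrev PhaseSpace (d : ℕ) : Type := Euc (Fin d ⊕ Fin d)

/-- `(x, y) ↦ x`. -/
def fstL (d : ℕ) : PhaseSpace d →L[ℝ] Euc (Fin d) :=
  (ContinuousLinearMap.fst ℝ _ _).comp
    (EuclideanSpace.sumEquivProd (𝕜 := ℝ) (ι := Fin d) (κ := Fin d)).toContinuousLinearMap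

/-- `(x, y) ↦ y`. -/
def sndL (d : ℕ) : PhaseSpace d →L[ℝ] Euc (Fin d) :=
  (ContinuousLinearMap.snd ℝ _ _).comp
    (EuclideanSpace.sumEquivProd (𝕜 := ℝ) (ι := Fin d) (κ := Fin d)).toContinuousLinearMap

/-- `x ↦ (x, 0)`. -/
def inlL (d : ℕ) : Euc (Fin d) →L[ℝ] PhaseSpace d :=
  (EuclideanSpace.sumEquivProd (𝕜 := ℝ) (ι := Fin d) (κ := Fin d)).symm.toContinuousLinearMap.comp
    (ContinuousLinearMap.inl ℝ _ _)

/-- `y ↦ (0, y)`. -/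
def inrL (d : ℕ) : Euc (Fin d) →L[ℝ] PhaseSpace d :=
  (EuclideanSpace.sumEquivProd (𝕜 := ℝ) (ι := Fin d) (κ := Fin d)).symm.toContinuousLinearMap.comp
    (ContinuousLinearMap.inr ℝ _ _)

/-- The point `(x, y)`. -/
def toPair {d : ℕ} (x y : Euc (Fin d)) : PhaseSpace d := WithLp.toLp 2 (Sum.elim x.ofLp y.ofLp)

variable {d : ℕ}

theorem toPair_eq (x y : Euc (Fin d)) : toPair x y = inlL d x + inrL d y := by
  ext i
  cases i <;> simp [toPair, inlL, inrL]

@[simp] theorem fstL_toPair (x y : Euc (Fin d)) : fstL d (toPair x y) = x := rfl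
@[simp] theorem sndL_toPair (x y : Euc (Fin d)) : sndL d (toPair x y) = y := rfl
@[simp] theorem toPair_fst_snd (z : PhaseSpace d) : toPair (fstL d z) (sndL d z) = z := by
  ext i
  cases i <;> rfl

theorem norm_toPair_sq (x y : Euc (Fin d)) : ‖toPair x y‖ ^ 2 = ‖x‖ ^ 2 + ‖y‖ ^ 2 := by
  simp [EuclideanSpace.norm_sq_eq, toPair]

theorem norm_inrL (y : Euc (Fin d)) : ‖inrL d y‖ = ‖y‖ := by
  have h := norm_toPair_sq 0 y
  rw [toPair_eq] at h
  simp only [map_zero, zero_add, norm_zero, ne_eq, OfNat.ofNat_ne_zero, not_false_eq_true,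
    zero_pow] at h
  exact (sq_eq_sq₀ (norm_nonneg _) (norm_nonneg _)).1 h

theorem norm_le_toPair_left (x y : Euc (Fin d)) : ‖x‖ ≤ ‖toPair x y‖ := by
  have h := norm_toPair_sq x y
  exact (sq_le_sq₀ (norm_nonneg _) (norm_nonneg _)).1 (by nlinarith [sq_nonneg ‖y‖])

theorem norm_le_toPair_right (x y : Euc (Fin d)) : ‖y‖ ≤ ‖toPair x y‖ := by
  have h := norm_toPair_sq x y
  exact (sq_le_sq₀ (norm_nonneg _) (norm_nonneg _)).1 (by nlinarith [sq_nonneg ‖x‖])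

theorem norm_toPair_le (x y : Euc (Fin d)) : ‖toPair x y‖ ≤ ‖x‖ + ‖y‖ := by
  have h := norm_toPair_sq x y
  exact (sq_le_sq₀ (norm_nonneg _) (by positivity)).1
    (by nlinarith [mul_nonneg (norm_nonneg x) (norm_nonneg y)])

section Schwartz

variable {W : Type} [NormedAddCommGroup W] [NormedSpace ℂ W]

theorem toPair_hasTemperateGrowth (x : Euc (Fin d)) :
    Function.HasTemperateGrowth (fun y : Euc (Fin d) => toPair x y) := by
  simp_rw [toPair_eq]
  exact (Function.HasTemperateGrowth.const _).add (inrL d).hasTemperateGrowth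

/-- The section `y ↦ F (x, y)` of a Schwartz function. -/
def sectionCLM (x : Euc (Fin d)) : 𝓢(PhaseSpace d, W) →L[ℂ] 𝓢(Euc (Fin d), W) :=
  SchwartzMap.compCLM ℂ (toPair_hasTemperateGrowth x)
    ⟨1, 1, fun y => by linarith [norm_le_toPair_right x y]⟩

@[simp] theorem sectionCLM_apply (x y : Euc (Fin d)) (F : 𝓢(PhaseSpace d, W)) :
    sectionCLM x F y = F (toPair x y) := rfl

theorem norm_iteratedFDeriv_section_le (x y : Euc (Fin d)) (F : 𝓢(PhaseSpace d, W)) (n : ℕ) :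
    ‖iteratedFDeriv ℝ n (sectionCLM x F) y‖ ≤ ‖iteratedFDeriv ℝ n F (toPair x y)‖ := by
  have h1 : (sectionCLM x F : Euc (Fin d) → W) = (fun z => F (inlL d x + z)) ∘ inrL d := by
    ext y
    simp [toPair_eq]
  have h2 : ContDiff ℝ n (fun z => F (inlL d x + z)) := (F.smooth n).comp (by fun_prop)
  rw [h1, (inrL d).iteratedFDeriv_comp_right h2 y le_rfl, iteratedFDeriv_comp_add_left,
    ← toPair_eq]
  refine (ContinuousMultilinearMap.norm_compContinuousLinearMap_le _ _).trans ?_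
  have h3 : ‖inrL d‖ ≤ 1 :=
    ContinuousLinearMap.opNorm_le_bound _ zero_le_one fun y => by rw [norm_inrL, one_mul]
  exact mul_le_of_le_one_right (norm_nonneg _)
    (Finset.prod_le_one (fun _ _ => norm_nonneg _) fun _ _ => h3)

theorem pow_mul_seminorm_section_le (x : Euc (Fin d)) (F : 𝓢(PhaseSpace d, W)) (m a b : ℕ) :
    ‖x‖ ^ m * SchwartzMap.seminorm ℂ a b (sectionCLM x F) ≤ SchwartzMap.seminorm ℂ (m + a) b F := by
  have h : SchwartzMap.seminorm ℂ a b (((‖x‖ ^ m : ℝ) : ℂ) • sectionCLM x F) ≤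
      SchwartzMap.seminorm ℂ (m + a) b F := by
    refine SchwartzMap.seminorm_le_bound ℂ a b _ (apply_nonneg _ _) fun y => ?_
    have h1 : iteratedFDeriv ℝ b (((‖x‖ ^ m : ℝ) : ℂ) • sectionCLM x F : 𝓢(Euc (Fin d), W)) y =
        ((‖x‖ ^ m : ℝ) : ℂ) • iteratedFDeriv ℝ b (sectionCLM x F) y :=
      iteratedFDeriv_const_smul_apply ((sectionCLM x F).smooth b).contDiffAt
    rw [h1, norm_smul, Complex.norm_real, Real.norm_of_nonneg (by positivity)]
    refine le_trans ?_ (SchwartzMap.le_seminorm ℂ (m + a) b F (toPair x y))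
    rw [pow_add]
    calc ‖y‖ ^ a * (‖x‖ ^ m * ‖iteratedFDeriv ℝ b (sectionCLM x F) y‖)
        = ‖x‖ ^ m * ‖y‖ ^ a * ‖iteratedFDeriv ℝ b (sectionCLM x F) y‖ := by ring
      _ ≤ _ := by
        gcongr
        · exact norm_le_toPair_left x y
        · exact norm_le_toPair_right x y
        · exact norm_iteratedFDeriv_section_le x y F b
  rwa [map_smul_eq_mul, Complex.norm_real, Real.norm_of_nonneg (by positivity)] at h

/-- `F₂ F (x, ω) = ∫ exp (-2 π i ω · y) F (x, y) dy`. -/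
def partialFourier (F : PhaseSpace d → W) (z : PhaseSpace d) : W :=
  𝓕 (fun y : Euc (Fin d) => F (toPair (fstL d z) y)) (sndL d z)

theorem partialFourier_eq_section (F : 𝓢(PhaseSpace d, W)) (z : PhaseSpace d) :
    partialFourier F z = 𝓕 (sectionCLM (fstL d z) F) (sndL d z) := rfl

theorem seminorm_sum_apply {X κ : Type} [AddCommGroup X] [Module ℂ X] (p : κ → Seminorm ℂ X)
    (s : Finset κ) (x : X) : (∑ i ∈ s, p i) x = ∑ i ∈ s, p i x := by
  classical
  induction s using Finset.induction_on with
  | empty => simp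
  | insert a s ha ih => simp [Finset.sum_insert ha, ih]

theorem exists_bound_fst_snd (m k : ℕ) : ∃ q : Seminorm ℂ 𝓢(PhaseSpace d, W), Continuous q ∧
    ∀ (F : 𝓢(PhaseSpace d, W)) (z : PhaseSpace d),
      ‖fstL d z‖ ^ m * (‖sndL d z‖ ^ k * ‖partialFourier F z‖) ≤ q F := by
  let T : 𝓢(Euc (Fin d), W) →L[ℂ] 𝓢(Euc (Fin d), W) := FourierTransform.fourierCLM ℂ 𝓢(Euc (Fin d), W)
  let p : Seminorm ℂ 𝓢(Euc (Fin d), W) := (SchwartzMap.seminorm ℂ k 0).comp T.toLinearMap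
  have hp : Continuous p :=
    ((schwartz_withSeminorms ℂ (Euc (Fin d)) W).continuous_seminorm (k, 0)).comp T.continuous
  obtain ⟨s, C, -, hC⟩ := Seminorm.bound_of_continuous (schwartz_withSeminorms ℂ (Euc (Fin d)) W) p hp
  refine ⟨C • ∑ i ∈ s, SchwartzMap.seminorm ℂ (m + i.1) i.2, ?_, fun F z => ?_⟩
  · have : Continuous fun F : 𝓢(PhaseSpace d, W) =>
        (C : ℝ) * ∑ i ∈ s, SchwartzMap.seminorm ℂ (m + i.1) i.2 F :=
      continuous_const.mul (continuous_finsetSum _ fun i _ =>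
        (schwartz_withSeminorms ℂ (PhaseSpace d) W).continuous_seminorm (m + i.1, i.2))
    convert this using 2 with F
    simp [NNReal.smul_def]
  · set x := fstL d z
    have h1 : ‖sndL d z‖ ^ k * ‖partialFourier F z‖ ≤ p (sectionCLM x F) := by
      have := SchwartzMap.le_seminorm ℂ k 0 (T (sectionCLM x F)) (sndL d z)
      rw [norm_iteratedFDeriv_zero] at this
      exact this
    have h2 : p (sectionCLM x F) ≤
        C * ∑ i ∈ s, SchwartzMap.seminorm ℂ i.1 i.2 (sectionCLM x F) := by
      refine (hC _).trans ?_
      have := Seminorm.finset_sup_le_sum (schwartzSeminormFamily ℂ (Euc (Fin d)) W) s (sectionCLM x F)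
      rw [seminorm_sum_apply] at this
      simp only [smul_apply, NNReal.smul_def, smul_eq_mul]
      gcongr
      exact this
    have h3 : ((C • ∑ i ∈ s, SchwartzMap.seminorm ℂ (m + i.1) i.2 : Seminorm ℂ 𝓢(PhaseSpace d, W)) F) =
        (C : ℝ) * ∑ i ∈ s, SchwartzMap.seminorm ℂ (m + i.1) i.2 F := by
      simp [NNReal.smul_def]
    rw [h3]
    calc _ ≤ ‖x‖ ^ m * (C * ∑ i ∈ s, SchwartzMap.seminorm ℂ i.1 i.2 (sectionCLM x F)) := by
          exact mul_le_mul_of_nonneg_left (h1.trans h2) (by positivity)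
      _ = C * ∑ i ∈ s, ‖x‖ ^ m * SchwartzMap.seminorm ℂ i.1 i.2 (sectionCLM x F) := by
          rw [Finset.mul_sum, Finset.mul_sum, Finset.mul_sum]
          refine Finset.sum_congr rfl fun i _ => by ring
      _ ≤ _ := by
          gcongr with i _
          exact pow_mul_seminorm_section_le x F m i.1 i.2

theorem exists_bound (k : ℕ) : ∃ q : Seminorm ℂ 𝓢(PhaseSpace d, W), Continuous q ∧
    ∀ (F : 𝓢(PhaseSpace d, W)) (z : PhaseSpace d), ‖z‖ ^ k * ‖partialFourier F z‖ ≤ q F := by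
  obtain ⟨q₁, hq₁, h₁⟩ := exists_bound_fst_snd (d := d) (W := W) k 0
  obtain ⟨q₂, hq₂, h₂⟩ := exists_bound_fst_snd (d := d) (W := W) 0 k
  refine ⟨(2 ^ k : NNReal) • (q₁ + q₂), ?_, fun F z => ?_⟩
  · exact (continuous_const.mul (hq₁.add hq₂) : Continuous fun F => (2 ^ k : NNReal) * (q₁ F + q₂ F))
  · have e : (((2 ^ k : NNReal) • (q₁ + q₂)) F : ℝ) = 2 ^ k * (q₁ F + q₂ F) := by
      simp [NNReal.smul_def, mul_add]
    have hz : ‖z‖ ^ k ≤ 2 ^ k * (‖fstL d z‖ ^ k + ‖sndL d z‖ ^ k) := by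
      have h0 : ‖z‖ ≤ ‖fstL d z‖ + ‖sndL d z‖ := by
        conv_lhs => rw [← toPair_fst_snd z]
        exact norm_toPair_le _ _
      calc ‖z‖ ^ k ≤ (2 * max ‖fstL d z‖ ‖sndL d z‖) ^ k := by
            gcongr
            linarith [le_max_left ‖fstL d z‖ ‖sndL d z‖, le_max_right ‖fstL d z‖ ‖sndL d z‖]
        _ = 2 ^ k * max ‖fstL d z‖ ‖sndL d z‖ ^ k := mul_pow _ _ _
        _ ≤ _ := by
            gcongr
            rcases max_cases ‖fstL d z‖ ‖sndL d z‖ with h | h <;> rw [h.1]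
            · exact le_add_of_nonneg_right (by positivity)
            · exact le_add_of_nonneg_left (by positivity)
    have g₁ := h₁ F z
    have g₂ := h₂ F z
    simp only [pow_zero, one_mul] at g₁ g₂
    rw [e]
    calc _ ≤ 2 ^ k * (‖fstL d z‖ ^ k + ‖sndL d z‖ ^ k) * ‖partialFourier F z‖ := by gcongr
      _ = 2 ^ k * (‖fstL d z‖ ^ k * ‖partialFourier F z‖ +
            ‖sndL d z‖ ^ k * ‖partialFourier F z‖) := by ring
      _ ≤ _ := by gcongr

/-- Composition with a fixed real-linear map on the right, as a complex-linear map. -/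
def compRightL (P : PhaseSpace d →L[ℝ] PhaseSpace d) : (PhaseSpace d →L[ℝ] W) →L[ℂ] (PhaseSpace d →L[ℝ] W) :=
  LinearMap.mkContinuous
    { toFun := fun f => f.comp P
      map_add' := fun _ _ => rfl
      map_smul' := fun _ _ => rfl } ‖P‖
    fun f => (f.opNorm_comp_le P).trans_eq (mul_comm _ _)

/-- The pairing `(z, w) ↦ ⟨snd z, snd w⟩`. -/
def sndInner (d : ℕ) : PhaseSpace d →L[ℝ] PhaseSpace d →L[ℝ] ℝ :=
  (innerSL ℝ (E := Euc (Fin d))).bilinearComp (sndL d) (sndL d)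

/-- The Schwartz function whose partial Fourier transform is the derivative of that of `F`. -/
def derivAux : 𝓢(PhaseSpace d, W) →L[ℂ] 𝓢(PhaseSpace d, PhaseSpace d →L[ℝ] W) :=
  SchwartzMap.postcompCLM (compRightL ((inlL d).comp (fstL d))) ∘L SchwartzMap.fderivCLM ℂ (PhaseSpace d) W
    + (-(2 * Real.pi * Complex.I)) • SchwartzMap.smulRightCLM ℂ W (sndInner d)

theorem derivAux_apply (F : 𝓢(PhaseSpace d, W)) (z : PhaseSpace d) :
    derivAux F z = (fderiv ℝ F z).comp ((inlL d).comp (fstL d)) +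
      (-(2 * Real.pi * Complex.I)) • (sndInner d z).smulRight (F z) := rfl

theorem exists_integrable_bound {X : Type} [NormedAddCommGroup X] [NormedSpace ℝ X]
    (F : 𝓢(PhaseSpace d, X)) : ∃ b : Euc (Fin d) → ℝ, Integrable b ∧ ∀ x y, ‖F (toPair x y)‖ ≤ b y := by
  let N := (volume : Measure (Euc (Fin d))).integrablePower
  let C := 2 ^ N * (Finset.Iic (N, 0)).sup (fun m => SchwartzMap.seminorm ℝ m.1 m.2) F
  refine ⟨fun y => C * (1 + ‖y‖) ^ (-(N : ℝ)),
    (Measure.integrable_pow_neg_integrablePower volume).const_mul C, fun x y => ?_⟩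
  have h := SchwartzMap.one_add_le_sup_seminorm_apply (𝕜 := ℝ) (m := (N, 0)) le_rfl le_rfl F
    (toPair x y)
  rw [norm_iteratedFDeriv_zero] at h
  beta_reduce
  rw [Real.rpow_neg (by positivity), ← div_eq_mul_inv, le_div_iff₀ (by positivity),
    Real.rpow_natCast, mul_comm]
  refine le_trans ?_ h
  gcongr
  exact norm_le_toPair_right x y

theorem hasFDerivAt_partialFourier (F : 𝓢(PhaseSpace d, W)) (z₀ : PhaseSpace d) :
    HasFDerivAt (partialFourier F) (partialFourier (derivAux F) z₀) z₀ := by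
  let L : Euc (Fin d) →L[ℝ] PhaseSpace d →L[ℝ] ℝ :=
    (innerSL ℝ (E := Euc (Fin d))).bilinearComp (ContinuousLinearMap.id ℝ _) (sndL d)
  let P : PhaseSpace d →L[ℝ] PhaseSpace d := (inlL d).comp (fstL d)
  have hP (z : PhaseSpace d) (y : Euc (Fin d)) : toPair (fstL d z) y = P z + inrL d y := toPair_eq _ _
  have hpair (z : PhaseSpace d) : Continuous fun y : Euc (Fin d) => toPair (fstL d z) y := by
    simp_rw [hP]; fun_prop
  have hexp (z : PhaseSpace d) : Continuous fun y : Euc (Fin d) => (𝐞 (-L y z) : ℂ) := by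
    have : Continuous fun y : Euc (Fin d) => -L y z := by
      change Continuous fun y : Euc (Fin d) => -inner ℝ y (sndL d z)
      fun_prop
    exact continuous_subtype_val.comp (Real.continuous_fourierChar.comp this)
  have h1 {X : Type} [NormedAddCommGroup X] [NormedSpace ℂ X] (G : PhaseSpace d → X) (z : PhaseSpace d) :
      partialFourier G z = ∫ y, (𝐞 (-L y z) : ℂ) • G (toPair (fstL d z) y) := by
    rw [partialFourier, Real.fourier_eq]
    rfl
  obtain ⟨b, hb, hFb⟩ := exists_integrable_bound F
  obtain ⟨b', hb', hFb'⟩ := exists_integrable_bound (derivAux F)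
  have hm (z : PhaseSpace d) :
      AEStronglyMeasurable (fun y => (𝐞 (-L y z) : ℂ) • F (toPair (fstL d z) y)) volume :=
    ((hexp z).smul (F.continuous.comp (hpair z))).aestronglyMeasurable
  have hd (y : Euc (Fin d)) (z : PhaseSpace d) :
      HasFDerivAt (fun z => (𝐞 (-L y z) : ℂ) • F (toPair (fstL d z) y))
        ((𝐞 (-L y z) : ℂ) • derivAux F (toPair (fstL d z) y)) z := by
    have e1 := Real.hasFDerivAt_fourierChar_neg_bilinear_right L y z
    have e2 : HasFDerivAt (fun z => F (toPair (fstL d z) y))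
        ((fderiv ℝ F (toPair (fstL d z) y)).comp P) z := by
      have e3 : HasFDerivAt (fun z => P z + inrL d y) P z := P.hasFDerivAt.add_const _
      simp_rw [hP]
      exact (F.hasFDerivAt _).comp z e3
    refine (e1.smul e2).congr_fderiv ?_
    rw [derivAux_apply, smul_add]
    congr 1
    ext w
    have e4 : sndInner d (toPair (fstL d z) y) w = L y w := rfl
    simp only [ContinuousLinearMap.smulRight_apply, smul_apply,
      ContinuousLinearMap.comp_apply, Complex.ofRealCLM_apply, e4]
    rw [← Complex.coe_smul (L y w), smul_smul, smul_smul, smul_eq_mul]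
    congr 1
    ring
  have key := hasFDerivAt_integral_of_dominated_of_fderiv_le (𝕜 := ℝ) (μ := volume)
    (F := fun z y => (𝐞 (-L y z) : ℂ) • F (toPair (fstL d z) y))
    (F' := fun z y => (𝐞 (-L y z) : ℂ) • derivAux F (toPair (fstL d z) y))
    (x₀ := z₀) (bound := b') Filter.univ_mem (Filter.Eventually.of_forall hm)
    (hb.mono' (hm z₀) (Filter.Eventually.of_forall fun y => ?_))
    ((hexp z₀).smul ((derivAux F).continuous.comp (hpair z₀))).aestronglyMeasurable
    (Filter.Eventually.of_forall fun y z _ => ?_) hb'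
    (Filter.Eventually.of_forall fun y z _ => hd y z)
  · rw [h1]
    refine key.congr_of_eventuallyEq (Filter.Eventually.of_forall fun z => ?_)
    exact h1 F z
  · rw [norm_smul, Circle.norm_coe, one_mul]
    exact hFb _ _
  · rw [norm_smul, Circle.norm_coe, one_mul]
    exact hFb' _ _

end Schwartz

theorem contDiff_partialFourier_nat (n : ℕ) : ∀ {W : Type} [NormedAddCommGroup W] [NormedSpace ℂ W]
    (F : 𝓢(PhaseSpace d, W)), ContDiff ℝ n (partialFourier F) := by
  induction n with
  | zero =>
    intro W _ _ F
    exact contDiff_zero.2 (continuous_iff_continuousAt.2 fun z =>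
      (hasFDerivAt_partialFourier F z).continuousAt)
  | succ n ih =>
    intro W _ _ F
    rw [Nat.cast_succ, contDiff_succ_iff_hasFDerivAt]
    exact ⟨partialFourier (derivAux F), ih _, hasFDerivAt_partialFourier F⟩

theorem exists_bound_iteratedFDeriv (n : ℕ) :
    ∀ {W : Type} [NormedAddCommGroup W] [NormedSpace ℂ W] (k : ℕ),
      ∃ q : Seminorm ℂ 𝓢(PhaseSpace d, W), Continuous q ∧ ∀ (F : 𝓢(PhaseSpace d, W)) (z : PhaseSpace d),
        ‖z‖ ^ k * ‖iteratedFDeriv ℝ n (partialFourier F) z‖ ≤ q F := by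
  induction n with
  | zero =>
    intro W _ _ k
    simpa only [norm_iteratedFDeriv_zero] using exists_bound (d := d) (W := W) k
  | succ n ih =>
    intro W _ _ k
    obtain ⟨q, hq, h⟩ := ih (W := PhaseSpace d →L[ℝ] W) k
    refine ⟨q.comp (derivAux (d := d) (W := W)).toLinearMap,
      hq.comp (derivAux (d := d) (W := W)).continuous, fun F z => ?_⟩
    have e : fderiv ℝ (partialFourier F) = partialFourier (derivAux F) :=
      funext fun z => (hasFDerivAt_partialFourier F z).fderiv
    rw [← norm_iteratedFDeriv_fderiv, e]
    exact h (derivAux F) z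

/-- The partial Fourier transform in the second variable on Schwartz functions. -/
def partialFourierCLM (d : ℕ) : 𝓢(PhaseSpace d, ℂ) →L[ℂ] 𝓢(PhaseSpace d, ℂ) :=
  SchwartzMap.mkCLM (fun F => partialFourier F)
    (fun F G z => by
      rw [partialFourier_eq_section, partialFourier_eq_section, partialFourier_eq_section, map_add,
        FourierTransform.fourier_add]
      rfl)
    (fun c F z => by
      rw [partialFourier_eq_section, partialFourier_eq_section, map_smul,
        FourierTransform.fourier_smul]
      rfl)
    (fun F => contDiff_infty.2 fun n => contDiff_partialFourier_nat n F)
    (fun m => by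
      obtain ⟨q, hq, h⟩ := exists_bound_iteratedFDeriv (d := d) m.2 (W := ℂ) m.1
      obtain ⟨s, C, -, hC⟩ :=
        Seminorm.bound_of_continuous (schwartz_withSeminorms ℂ (PhaseSpace d) ℂ) q hq
      exact ⟨s, C, C.2, fun F z => (h F z).trans (hC F)⟩)

theorem partialFourierCLM_apply (F : 𝓢(PhaseSpace d, ℂ)) (z : PhaseSpace d) :
    partialFourierCLM d F z = 𝓕 (fun y => F (toPair (fstL d z) y)) (sndL d z) := rfl


theorem fst_sub_snd_hom (z : PhaseSpace d) :
    toPair (fstL d z) (-sndL d z) = inlL d (fstL d z) - inrL d (sndL d z) := by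
  rw [toPair_eq, map_neg, sub_eq_add_neg]

/-- The reflection `(x, y) ↦ (x, -y)`. -/
def flipSnd (d : ℕ) : PhaseSpace d ≃L[ℝ] PhaseSpace d :=
  ContinuousLinearEquiv.equivOfInverse
    ((inlL d).comp (fstL d) - (inrL d).comp (sndL d))
    ((inlL d).comp (fstL d) - (inrL d).comp (sndL d))
    (fun z => by
      change inlL d (fstL d (inlL d (fstL d z) - inrL d (sndL d z))) -
        inrL d (sndL d (inlL d (fstL d z) - inrL d (sndL d z))) = z
      rw [← fst_sub_snd_hom z, fstL_toPair, sndL_toPair, map_neg, sub_neg_eq_add, ← toPair_eq,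
        toPair_fst_snd])
    (fun z => by
      change inlL d (fstL d (inlL d (fstL d z) - inrL d (sndL d z))) -
        inrL d (sndL d (inlL d (fstL d z) - inrL d (sndL d z))) = z
      rw [← fst_sub_snd_hom z, fstL_toPair, sndL_toPair, map_neg, sub_neg_eq_add, ← toPair_eq,
        toPair_fst_snd])

theorem flipSnd_apply (z : PhaseSpace d) : flipSnd d z = toPair (fstL d z) (-sndL d z) :=
  (fst_sub_snd_hom z).symm

/-- The inverse partial Fourier transform in the second variable on Schwartz functions. -/
def partialFourierInvCLM (d : ℕ) : 𝓢(PhaseSpace d, ℂ) →L[ℂ] 𝓢(PhaseSpace d, ℂ) :=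
  (SchwartzMap.compCLMOfContinuousLinearEquiv ℂ (flipSnd d)).comp (partialFourierCLM d)

/-- `F₂⁻¹ F (x, y) = ∫ exp (2 π i y · ω) F (x, ω) dω`. -/
theorem partialFourierInvCLM_apply (F : 𝓢(PhaseSpace d, ℂ)) (z : PhaseSpace d) :
    partialFourierInvCLM d F z = 𝓕⁻ (fun y => F (toPair (fstL d z) y)) (sndL d z) := by
  change partialFourierCLM d F (flipSnd d z) = _
  rw [flipSnd_apply, partialFourierCLM_apply, Real.fourierInv_eq_fourier_neg, fstL_toPair,
    sndL_toPair]

theorem partialFourierInvCLM_partialFourierCLM (F : 𝓢(PhaseSpace d, ℂ)) :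
    partialFourierInvCLM d (partialFourierCLM d F) = F := by
  ext z
  rw [partialFourierInvCLM_apply]
  have h : (fun y => partialFourierCLM d F (toPair (fstL d z) y)) =
      (𝓕 (sectionCLM (fstL d z) F) : 𝓢(Euc (Fin d), ℂ)) := rfl
  rw [h, ← SchwartzMap.fourierInv_coe, FourierTransform.fourierInv_fourier_eq,
    sectionCLM_apply, toPair_fst_snd]

theorem partialFourierCLM_partialFourierInvCLM (F : 𝓢(PhaseSpace d, ℂ)) :
    partialFourierCLM d (partialFourierInvCLM d F) = F := by
  ext z
  rw [partialFourierCLM_apply]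
  have h : (fun y => partialFourierInvCLM d F (toPair (fstL d z) y)) =
      (𝓕⁻ (sectionCLM (fstL d z) F) : 𝓢(Euc (Fin d), ℂ)) := by
    ext y
    rw [partialFourierInvCLM_apply, SchwartzMap.fourierInv_coe]
    rfl
  rw [h, ← SchwartzMap.fourier_coe, FourierTransform.fourier_fourierInv_eq,
    sectionCLM_apply, toPair_fst_snd]

/-- The partial Fourier transform `F₂` of tempered distributions, by transposition. -/
def partialFourierDist (d : ℕ) : 𝓢'(PhaseSpace d, ℂ) →L[ℂ] 𝓢'(PhaseSpace d, ℂ) :=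
  PointwiseConvergenceCLM.precomp ℂ (partialFourierCLM d)

/-- The inverse partial Fourier transform `F₂⁻¹` of tempered distributions, by transposition. -/
def partialFourierInvDist (d : ℕ) : 𝓢'(PhaseSpace d, ℂ) →L[ℂ] 𝓢'(PhaseSpace d, ℂ) :=
  PointwiseConvergenceCLM.precomp ℂ (partialFourierInvCLM d)

theorem partialFourierInvDist_partialFourierDist (u : 𝓢'(PhaseSpace d, ℂ)) :
    partialFourierInvDist d (partialFourierDist d u) = u := by
  ext F
  exact congrArg u (partialFourierCLM_partialFourierInvCLM F)

theorem partialFourierDist_partialFourierInvDist (u : 𝓢'(PhaseSpace d, ℂ)) :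
    partialFourierDist d (partialFourierInvDist d u) = u := by
  ext F
  exact congrArg u (partialFourierInvCLM_partialFourierCLM F)

/-! ### Linear changes of coordinates -/

/-- An invertible matrix acting on column vectors, as a linear homeomorphism. -/
def glEquiv {ι : Type} [Fintype ι] [DecidableEq ι] (A : Matrix.GeneralLinearGroup ι ℝ) :
    Euc ι ≃L[ℝ] Euc ι :=
  ContinuousLinearEquiv.unitsEquiv ℝ (Euc ι)
    (Units.map (Matrix.toEuclideanCLM (n := ι) (𝕜 := ℝ)).toRingEquiv.toMonoidHom A)

theorem glEquiv_apply {ι : Type} [Fintype ι] [DecidableEq ι] (A : Matrix.GeneralLinearGroup ι ℝ)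
    (z : Euc ι) : glEquiv A z = WithLp.toLp 2 ((A : Matrix ι ι ℝ).mulVec z.ofLp) := rfl

/-- `T_A F (z) = F (A z)` for functions. -/
def coordTransform {ι : Type} [Fintype ι] [DecidableEq ι] (A : Matrix.GeneralLinearGroup ι ℝ)
    (F : Euc ι → ℂ) (z : Euc ι) : ℂ :=
  F (glEquiv A z)

/-- `T_A` on tempered distributions: `(T_A u) (φ) = |det A|⁻¹ u (φ ∘ A⁻¹)`, which extends
`T_A F = F ∘ A`. -/
def coordTransformDist {ι : Type} [Fintype ι] [DecidableEq ι]
    (A : Matrix.GeneralLinearGroup ι ℝ) : 𝓢'(Euc ι, ℂ) →L[ℂ] 𝓢'(Euc ι, ℂ) :=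
  ((|(A : Matrix ι ι ℝ).det|⁻¹ : ℝ) : ℂ) •
    PointwiseConvergenceCLM.precomp ℂ
      (SchwartzMap.compCLMOfContinuousLinearEquiv ℂ (glEquiv A⁻¹))

/-! ### Gaussian window, time-frequency shifts, short-time Fourier transform -/

section Gaussian

variable {V : Type} [NormedAddCommGroup V] [InnerProductSpace ℝ V]

theorem pow_mul_exp_neg_le (M : ℕ) (r : ℝ) (hr : 0 ≤ r) :
    (1 + r) ^ M * Real.exp (-Real.pi * r ^ 2) ≤ M.factorial * Real.exp 2 := by
  have h1 := Real.pow_div_factorial_le_exp (x := 1 + r) (by positivity) M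
  rw [div_le_iff₀ (by positivity)] at h1
  calc (1 + r) ^ M * Real.exp (-Real.pi * r ^ 2)
      ≤ Real.exp (1 + r) * M.factorial * Real.exp (-Real.pi * r ^ 2) := by gcongr
    _ = M.factorial * Real.exp (1 + r + -Real.pi * r ^ 2) := by rw [Real.exp_add (1 + r)]; ring
    _ ≤ _ := by
      gcongr
      nlinarith [Real.pi_gt_three, sq_nonneg (r - 1), sq_nonneg r]

/-- `exp (-π |t|²)` as a real Schwartz function. -/
def realGaussian (V : Type) [NormedAddCommGroup V] [InnerProductSpace ℝ V] : 𝓢(V, ℝ) where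
  toFun t := Real.exp (-Real.pi * ‖t‖ ^ 2)
  smooth' := (contDiff_const.mul (contDiff_norm_sq ℝ)).exp
  decay' k n := by
    have hq : Function.HasTemperateGrowth fun t : V => -Real.pi * ‖t‖ ^ 2 :=
      (Function.HasTemperateGrowth.const (-Real.pi)).mul (Function.hasTemperateGrowth_norm_sq V)
    obtain ⟨l, C, hC, h⟩ := hq.norm_iteratedFDeriv_le_uniform n
    refine ⟨n.factorial * (C + 1) ^ n * ((k + l * n).factorial * Real.exp 2), fun x => ?_⟩
    have hD (i : ℕ) (h1 : 1 ≤ i) (h2 : i ≤ n) :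
        ‖iteratedFDeriv ℝ i (fun t : V => -Real.pi * ‖t‖ ^ 2) x‖ ≤
          ((C + 1) * (1 + ‖x‖) ^ l) ^ i := by
      refine (h i h2 x).trans ?_
      have h3 : 1 ≤ (1 + ‖x‖) ^ l := one_le_pow₀ (by linarith [norm_nonneg x])
      calc C * (1 + ‖x‖) ^ l ≤ (C + 1) * (1 + ‖x‖) ^ l := by gcongr; linarith
        _ ≤ _ := le_self_pow₀ (by nlinarith) (by omega)
    have hE (i : ℕ) (_ : i ≤ n) : ‖iteratedFDeriv ℝ i Real.exp (-Real.pi * ‖x‖ ^ 2)‖ ≤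
        Real.exp (-Real.pi * ‖x‖ ^ 2) := by
      rw [norm_iteratedFDeriv_eq_norm_iteratedDeriv, iteratedDeriv_eq_iterate, Real.iter_deriv_exp,
        Real.norm_of_nonneg (Real.exp_pos _).le]
    have key := norm_iteratedFDeriv_comp_le (𝕜 := ℝ) (g := Real.exp) (n := n)
      (Real.contDiff_exp (n := (n : ℕ∞))) (hq.1.of_le (mod_cast le_top)) le_rfl x hE hD
    calc ‖x‖ ^ k * ‖iteratedFDeriv ℝ n (fun t : V => Real.exp (-Real.pi * ‖t‖ ^ 2)) x‖
        ≤ (1 + ‖x‖) ^ k * (n.factorial * Real.exp (-Real.pi * ‖x‖ ^ 2) *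
            ((C + 1) * (1 + ‖x‖) ^ l) ^ n) := by
          gcongr
          · linarith
          · exact key
      _ = n.factorial * (C + 1) ^ n *
            ((1 + ‖x‖) ^ (k + l * n) * Real.exp (-Real.pi * ‖x‖ ^ 2)) := by
          rw [mul_pow, pow_add, ← pow_mul]; ring
      _ ≤ _ := by
          exact mul_le_mul_of_nonneg_left (pow_mul_exp_neg_le _ _ (norm_nonneg x)) (by positivity)

theorem iteratedDeriv_fourierChar (n : ℕ) :
    iteratedDeriv n (fun s : ℝ => (𝐞 s : ℂ)) =
      fun s => (2 * Real.pi * Complex.I) ^ n * (𝐞 s : ℂ) := by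
  induction n with
  | zero => simp
  | succ n ih =>
    rw [iteratedDeriv_succ, ih]
    ext s
    rw [deriv_const_mul _ (Real.differentiable_fourierChar s), Real.deriv_fourierChar]
    ring

theorem hasTemperateGrowth_fourierChar :
    Function.HasTemperateGrowth fun s : ℝ => (𝐞 s : ℂ) := by
  refine ⟨?_, fun n => ⟨0, (2 * Real.pi) ^ n, fun x => ?_⟩⟩
  · have : (fun s : ℝ => (𝐞 s : ℂ)) = fun s : ℝ => Complex.exp (2 * Real.pi * s * Complex.I) := by
      ext s
      rw [Real.fourierChar_apply]
      push_cast
      rfl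
    rw [this]
    exact ((contDiff_const.mul Complex.ofRealCLM.contDiff).mul contDiff_const).cexp
  · rw [norm_iteratedFDeriv_eq_norm_iteratedDeriv, iteratedDeriv_fourierChar]
    rw [norm_mul, Circle.norm_coe]
    simp [abs_of_pos Real.pi_pos]

theorem hasTemperateGrowth_fourierChar_inner (ξ : V) :
    Function.HasTemperateGrowth fun t : V => (𝐞 (inner ℝ ξ t) : ℂ) :=
  hasTemperateGrowth_fourierChar.comp (innerSL ℝ ξ).hasTemperateGrowth

/-- The time-frequency shift `π(x, ω) f (t) = exp (2 π i ω · t) f (t - x)` of Schwartz functions. -/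
def timeFreqShift (z : V × V) : 𝓢(V, ℂ) →L[ℂ] 𝓢(V, ℂ) :=
  (SchwartzMap.smulLeftCLM ℂ fun t : V => (𝐞 (inner ℝ z.2 t) : ℂ)).comp
    (SchwartzMap.compSubConstCLM ℂ z.1)

theorem timeFreqShift_apply (z : V × V) (f : 𝓢(V, ℂ)) (t : V) :
    timeFreqShift z f t = (𝐞 (inner ℝ z.2 t) : ℂ) * f (t - z.1) := by
  rw [timeFreqShift, ContinuousLinearMap.comp_apply,
    SchwartzMap.smulLeftCLM_apply_apply (hasTemperateGrowth_fourierChar_inner z.2)]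
  rfl

/-- Pointwise complex conjugation of Schwartz functions. -/
def conjSchwartz (f : 𝓢(V, ℂ)) : 𝓢(V, ℂ) :=
  SchwartzMap.postcompCLM (𝕜 := ℝ) (Complex.conjCLE : ℂ →L[ℝ] ℂ) f

theorem conjSchwartz_apply (f : 𝓢(V, ℂ)) (t : V) :
    conjSchwartz f t = (starRingEnd ℂ) (f t) := rfl

end Gaussian

variable {ι : Type} [Fintype ι]

/-- The `L²`-normalized Gaussian `2 ^ (n / 4) exp (-π |t|²)` on `ℝⁿ`, the window of all short-time
Fourier transforms below. -/
def gaussian (ι : Type) [Fintype ι] : 𝓢(Euc ι, ℂ) :=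
  (((2 : ℝ) ^ ((Fintype.card ι : ℝ) / 4) : ℝ) : ℂ) •
    SchwartzMap.postcompCLM (𝕜 := ℝ) Complex.ofRealCLM (realGaussian (Euc ι))

theorem gaussian_apply (t : Euc ι) : gaussian ι t =
    (((2 : ℝ) ^ ((Fintype.card ι : ℝ) / 4) * Real.exp (-Real.pi * ‖t‖ ^ 2) : ℝ) : ℂ) := by
  rw [Complex.ofReal_mul]
  rfl

/-- The short-time Fourier transform `V_γ u (z) = ⟨u, π(z) γ⟩` of a tempered distribution, where
`⟨u, φ⟩` is `u` applied to the complex conjugate of `φ`. -/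
def stft (u : 𝓢'(Euc ι, ℂ)) (z : Euc ι × Euc ι) : ℂ :=
  u (conjSchwartz (timeFreqShift z (gaussian ι)))

/-- The short-time Fourier transform `V_γ F (z) = ∫ F (t) conj (π(z) γ (t)) dt` of a function. -/
def stftFun (F : Euc ι → ℂ) (z : Euc ι × Euc ι) : ℂ :=
  ∫ t, F t * (starRingEnd ℂ) (timeFreqShift z (gaussian ι) t)

/-! ### Modulation spaces -/

/-- The modulation space `M^p`: tempered distributions whose short-time Fourier transform is in
`L^p`. -/
def modulationSpace (ι : Type) [Fintype ι] (p : ℝ≥0∞) : Submodule ℂ 𝓢'(Euc ι, ℂ) where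
  carrier := {u | MemLp (stft u) p volume}
  add_mem' {_ _} hu hv := MemLp.add hu hv
  zero_mem' := MemLp.zero
  smul_mem' c _ hu := MemLp.const_smul hu c

/-- The Feichtinger algebra `M¹`, whose elements are `L²` functions: those `f ∈ L²` that belong to
`M¹` as tempered distributions. -/
def feichtinger (ι : Type) [Fintype ι] : Submodule ℂ (Lp ℂ 2 (volume : Measure (Euc ι))) :=
  (modulationSpace ι 1).comap (Lp.toTemperedDistributionCLM ℂ volume 2).toLinearMap

/-- The function underlying an element of `M¹`. -/
def toFunction (f : feichtinger ι) : Euc ι → ℂ := ((f : Lp ℂ 2 (volume : Measure (Euc ι))) :)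

/-- The sesquilinear duality of `M^∞` and `M¹`, extending the `L²` inner product (linear in the
first argument): `⟨u, F⟩ = ∫ V_γ u (z) conj (V_γ F (z)) dz`. No constant appears because
`‖γ‖₂ = 1`. -/
def duality (u : modulationSpace ι ⊤) (F : Euc ι → ℂ) : ℂ :=
  ∫ z, stft (u : 𝓢'(Euc ι, ℂ)) z * (starRingEnd ℂ) (stftFun F z)

/-! ### Matrix-Wigner distributions and the associated pseudodifferential operators -/

/-- `(f ⊗ conj g) (x, y) = f (x) conj (g (y))`. -/
def tensorConj (f g : Euc (Fin d) → ℂ) (z : PhaseSpace d) : ℂ :=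
  f (fstL d z) * (starRingEnd ℂ) (g (sndL d z))

/-- The matrix-Wigner distribution `B_A (f, g) = F₂ T_A (f ⊗ conj g)`, that is
`B_A (f, g) (x, ω) = ∫ exp (-2 π i ω · y) f (A₁₁ x + A₁₂ y) conj (g (A₂₁ x + A₂₂ y)) dy`. -/
def matrixWigner (A : Matrix.GeneralLinearGroup (Fin d ⊕ Fin d) ℝ) (f g : Euc (Fin d) → ℂ) :
    PhaseSpace d → ℂ :=
  partialFourier (coordTransform A (tensorConj f g))

/-- `u ∈ M^∞` is the value `σ^A f`: `⟨u, g⟩ = ⟨σ, B_A (g, f)⟩` for all `g ∈ M¹`. -/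
def IsOpValue (A : Matrix.GeneralLinearGroup (Fin d ⊕ Fin d) ℝ)
    (σ : modulationSpace (Fin d ⊕ Fin d) ⊤) (f : feichtinger (Fin d))
    (u : modulationSpace (Fin d) ⊤) : Prop :=
  ∀ g : feichtinger (Fin d),
    duality u (toFunction g) = duality σ (matrixWigner A (toFunction g) (toFunction f))

/-- The pseudodifferential operator `σ^A : M¹ → M^∞`, with `σ^A f` the element of `M^∞` singled out
by `IsOpValue`. -/
def op (A : Matrix.GeneralLinearGroup (Fin d ⊕ Fin d) ℝ)
    (σ : modulationSpace (Fin d ⊕ Fin d) ⊤) :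
    feichtinger (Fin d) → modulationSpace (Fin d) ⊤ :=
  fun f => Classical.epsilon (IsOpValue A σ f)

end MatrixWigner

end

noncomputable section

namespace MatrixWigner

section

/-! ### Translations of Schwartz functions: seminorm growth and continuity -/

section Translation

variable {V : Type} [NormedAddCommGroup V]

/-! Everything is tested on Gaussian shifts. Every g ∈ M¹ is a.e. the superposition ∫ V_γ g(w) π(w)γ
dw with integrable coefficients (`toFunction_ae_eq`). Expanding both arguments of B_A writes ⟨σ,
B_A(g, f)⟩ as the integral of conj (V_γ g(w)) V_γ f(w') against `wignerCoeff A σ (w, w')` = ⟨σ,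
B_A(π(w)γ, π(w')γ)⟩ (`duality_matrixWigner`). These coefficients are bounded, so integrating out w'
leaves a bounded function E, and V_γ^* E is the element of M^∞ sought (`exists_isOpValue`). It
follows that σ^A = ρ^B exactly when the two coefficient functions agree (`op_eq_op_iff`).

The function π(w)γ ⊗ conj (π(w')γ) is again a Gaussian shift, now on ℝ²ᵈ, and every shift arises in
this way. Transposing F₂ T_A therefore identifies the coefficients with the short-time Fourier
transform of the single distribution Φ ↦ σ(F₂⁻¹(Φ ∘ A)) (`stft_wignerPullback`). By injectivity of
that transform the coefficients agree iff these distributions do, and since Φ ↦ F₂⁻¹(Φ ∘ A) is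
invertible on the Schwartz space this is the relation between σ and ρ; the determinant quotient
cancels the Jacobian in T_{B⁻¹A} (`wignerPullback_eq_iff`).

Two analytic facts support this. One is the inversion formula u(conj φ) = ∫ V_γ u conj (V_γ φ) for
tempered u (`apply_conjSchwartz_eq_integral`), which requires moving u inside a Schwartz-valued
integral (`apply_eq_integral`). The other is covariance: F₂ T_A maps time-frequency shifts to
time-frequency shifts up to a unimodular factor, so the transforms of all B_A(π(w)γ, π(w')γ) have
the same L¹ norm. -/

theorem one_add_norm_le_mul (x t : V) : 1 + ‖t‖ ≤ (1 + ‖x‖) * (1 + ‖t - x‖) := by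
  have h : ‖t‖ ≤ ‖t - x‖ + ‖x‖ := by simpa using norm_add_le (t - x) x
  nlinarith [mul_nonneg (norm_nonneg x) (norm_nonneg (t - x))]

variable [NormedSpace ℝ V]

/-- A continuous seminorm dominating `(1 + ‖t‖) ^ k * ‖D^n f t‖`. -/
theorem exists_seminorm_one_add (k n : ℕ) : ∃ q : Seminorm ℂ 𝓢(V, ℂ), Continuous q ∧
    ∀ (f : 𝓢(V, ℂ)) (t : V), (1 + ‖t‖) ^ k * ‖iteratedFDeriv ℝ n f t‖ ≤ q f := by
  -- A sum in place of the supremum makes continuity immediate; 2 ^ k is the constant of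
  -- `SchwartzMap.one_add_le_sup_seminorm_apply`.
  refine ⟨(2 ^ k : NNReal) • ∑ i ∈ Finset.Iic (k, n), schwartzSeminormFamily ℂ V ℂ i, ?_,
    fun f t => ?_⟩
  · have : Continuous fun f : 𝓢(V, ℂ) => ((2 ^ k : NNReal) : ℝ) *
        ∑ i ∈ Finset.Iic (k, n), schwartzSeminormFamily ℂ V ℂ i f :=
      continuous_const.mul (continuous_finsetSum _ fun i _ =>
        (schwartz_withSeminorms ℂ V ℂ).continuous_seminorm i)
    convert this using 2 with f
    simp [NNReal.smul_def]
  · have h1 := SchwartzMap.one_add_le_sup_seminorm_apply (𝕜 := ℂ) (m := (k, n)) le_rfl le_rfl f t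
    have h2 := Seminorm.finset_sup_le_sum (schwartzSeminormFamily ℂ V ℂ) (Finset.Iic (k, n)) f
    rw [smul_apply, NNReal.smul_def, smul_eq_mul]
    simp only [NNReal.coe_pow, NNReal.coe_ofNat]
    exact h1.trans (mul_le_mul_of_nonneg_left h2 (by positivity))

/-- If the basic seminorms of `T z f` grow polynomially in `z`, so does every continuous one. -/
theorem exists_seminorm_bound_of_basic {X : Type} (T : X → 𝓢(V, ℂ) → 𝓢(V, ℂ)) (w : X → ℝ)
    (hw : ∀ z, 1 ≤ w z)
    (h : ∀ k n : ℕ, ∃ (N : ℕ) (q : Seminorm ℂ 𝓢(V, ℂ)), Continuous q ∧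
      ∀ z f, SchwartzMap.seminorm ℂ k n (T z f) ≤ w z ^ N * q f)
    (p : Seminorm ℂ 𝓢(V, ℂ)) (hp : Continuous p) :
    ∃ (N : ℕ) (q : Seminorm ℂ 𝓢(V, ℂ)), Continuous q ∧ ∀ z f, p (T z f) ≤ w z ^ N * q f := by
  obtain ⟨s, C, -, hC⟩ := Seminorm.bound_of_continuous (schwartz_withSeminorms ℂ V ℂ) p hp
  choose N q hq hb using h
  -- The sum of the exponents serves as a common exponent because `1 ≤ w z`.
  refine ⟨∑ i ∈ s, N i.1 i.2, C • ∑ i ∈ s, q i.1 i.2, ?_, fun z f => ?_⟩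
  · have : Continuous fun f : 𝓢(V, ℂ) => (C : ℝ) * ∑ i ∈ s, q i.1 i.2 f :=
      continuous_const.mul (continuous_finsetSum _ fun i _ => hq i.1 i.2)
    convert this using 2 with f
    simp [NNReal.smul_def]
  · have h1 := hC (T z f)
    have h2 := Seminorm.finset_sup_le_sum (schwartzSeminormFamily ℂ V ℂ) s (T z f)
    have e : (C • ∑ i ∈ s, q i.1 i.2 : Seminorm ℂ 𝓢(V, ℂ)) f = C * ∑ i ∈ s, q i.1 i.2 f := by
      simp [NNReal.smul_def]
    rw [seminorm_sum_apply] at h2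
    rw [smul_apply, NNReal.smul_def, smul_eq_mul] at h1
    rw [e]
    calc p (T z f) ≤ C * ∑ i ∈ s, schwartzSeminormFamily ℂ V ℂ i (T z f) :=
          h1.trans (mul_le_mul_of_nonneg_left h2 C.2)
      _ ≤ C * ∑ i ∈ s, w z ^ (∑ i ∈ s, N i.1 i.2) * q i.1 i.2 f := by
          gcongr with i hi
          refine (hb i.1 i.2 z f).trans ?_
          gcongr
          · exact hw z
          · exact Finset.single_le_sum (f := fun i : ℕ × ℕ => N i.1 i.2)
              (fun _ _ => Nat.zero_le _) hi
      _ = _ := by rw [← Finset.mul_sum]; ring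

theorem iteratedFDeriv_translate (f : 𝓢(V, ℂ)) (x t : V) (n : ℕ) :
    iteratedFDeriv ℝ n (f.compSubConstCLM ℂ x) t = iteratedFDeriv ℝ n f (t - x) := by
  have : (f.compSubConstCLM ℂ x : V → ℂ) = fun t => f (t - x) := rfl
  rw [this, iteratedFDeriv_comp_sub]

/-- Derivatives commute with translation, and `one_add_norm_le_mul` splits the weight at t into
weights at x and t - x. -/
theorem exists_seminorm_bound_translate (p : Seminorm ℂ 𝓢(V, ℂ)) (hp : Continuous p) :
    ∃ (N : ℕ) (q : Seminorm ℂ 𝓢(V, ℂ)), Continuous q ∧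
      ∀ (x : V) (f : 𝓢(V, ℂ)), p (f.compSubConstCLM ℂ x) ≤ (1 + ‖x‖) ^ N * q f := by
  refine exists_seminorm_bound_of_basic (fun x f => f.compSubConstCLM ℂ x) (fun x => 1 + ‖x‖)
    (fun x => by linarith [norm_nonneg x]) (fun k n => ?_) p hp
  obtain ⟨q, hq, h⟩ := exists_seminorm_one_add (V := V) k n
  refine ⟨k, q, hq, fun x f => SchwartzMap.seminorm_le_bound ℂ k n _ (by positivity) fun t => ?_⟩
  rw [iteratedFDeriv_translate]
  calc ‖t‖ ^ k * ‖iteratedFDeriv ℝ n f (t - x)‖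
      ≤ ((1 + ‖x‖) * (1 + ‖t - x‖)) ^ k * ‖iteratedFDeriv ℝ n f (t - x)‖ := by
        gcongr
        linarith [one_add_norm_le_mul x t]
    _ = (1 + ‖x‖) ^ k * ((1 + ‖t - x‖) ^ k * ‖iteratedFDeriv ℝ n f (t - x)‖) := by
        rw [mul_pow]; ring
    _ ≤ _ := by gcongr; exact h f _

/-- By the mean value inequality on the unit ball around t, each seminorm of the difference is
O(‖x‖) for ‖x‖ ≤ 1, at the price of one more derivative. -/
theorem tendsto_translate_zero (f : 𝓢(V, ℂ)) :
    Filter.Tendsto (fun x : V => f.compSubConstCLM ℂ x) (nhds 0) (nhds f) := by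
  rw [(schwartz_withSeminorms ℂ V ℂ).tendsto_nhds]
  rintro ⟨k, n⟩ ε hε
  obtain ⟨q, hq, h⟩ := exists_seminorm_one_add (V := V) k (n + 1)
  have hb (x : V) (hx : ‖x‖ ≤ 1) :
      SchwartzMap.seminorm ℂ k n (f.compSubConstCLM ℂ x - f) ≤ 2 ^ k * q f * ‖x‖ := by
    refine SchwartzMap.seminorm_le_bound ℂ k n _ (by positivity) fun t => ?_
    have e : iteratedFDeriv ℝ n (f.compSubConstCLM ℂ x - f : 𝓢(V, ℂ)) t =
        iteratedFDeriv ℝ n f (t - x) - iteratedFDeriv ℝ n f t := by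
      rw [← iteratedFDeriv_translate]
      exact iteratedFDeriv_sub_apply (SchwartzMap.contDiffAt _ n) (SchwartzMap.contDiffAt _ n)
    have hd (s : V) (hs : s ∈ Metric.closedBall t 1) :
        ‖fderiv ℝ (iteratedFDeriv ℝ n f) s‖ ≤ 2 ^ k * q f / (1 + ‖t‖) ^ k := by
      rw [norm_fderiv_iteratedFDeriv, le_div_iff₀ (by positivity), mul_comm]
      -- Within distance 1 of t the weights are comparable up to a factor 2, so the decay of the
      -- derivative at s is decay in t.
      have hts : 1 + ‖t‖ ≤ 2 * (1 + ‖s‖) := by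
        have h1 : ‖t‖ ≤ ‖s‖ + ‖t - s‖ := by simpa using norm_add_le s (t - s)
        have h2 : ‖t - s‖ ≤ 1 := by rwa [mem_closedBall_iff_norm'] at hs
        linarith [norm_nonneg s]
      calc (1 + ‖t‖) ^ k * ‖iteratedFDeriv ℝ (n + 1) f s‖
          ≤ (2 * (1 + ‖s‖)) ^ k * ‖iteratedFDeriv ℝ (n + 1) f s‖ := by gcongr
        _ = 2 ^ k * ((1 + ‖s‖) ^ k * ‖iteratedFDeriv ℝ (n + 1) f s‖) := by rw [mul_pow]; ring
        _ ≤ _ := by gcongr; exact h f s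
    have hdiff : Differentiable ℝ (iteratedFDeriv ℝ n f) :=
      (f.smooth ⊤).differentiable_iteratedFDeriv (by exact_mod_cast ENat.natCast_lt_top n)
    have key := (convex_closedBall t (1 : ℝ)).norm_image_sub_le_of_norm_fderiv_le (𝕜 := ℝ)
      (f := iteratedFDeriv ℝ n f) (x := t) (y := t - x) (fun s _ => hdiff s) hd
      (Metric.mem_closedBall_self zero_le_one) (by simpa [mem_closedBall_iff_norm] using hx)
    have hx' : ‖t - x - t‖ = ‖x‖ := by
      rw [sub_sub_cancel_left, norm_neg]
    rw [hx'] at key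
    rw [e]
    have hq0 : 0 ≤ q f := apply_nonneg _ _
    calc ‖t‖ ^ k * ‖iteratedFDeriv ℝ n f (t - x) - iteratedFDeriv ℝ n f t‖
        ≤ (1 + ‖t‖) ^ k * (2 ^ k * q f / (1 + ‖t‖) ^ k * ‖x‖) := by
          gcongr
          linarith
      _ = _ := by
          have : (1 + ‖t‖) ^ k ≠ 0 := by positivity
          field_simp
  have h0 : Filter.Tendsto (fun x : V => 2 ^ k * q f * ‖x‖) (nhds 0) (nhds 0) := by
    have : Continuous fun x : V => 2 ^ k * q f * ‖x‖ := by fun_prop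
    simpa using this.tendsto 0
  filter_upwards [h0.eventually (gt_mem_nhds hε), Metric.closedBall_mem_nhds (0 : V) one_pos]
    with x h1 h2
  exact (hb x (by simpa using h2)).trans_lt h1

theorem continuous_translate (f : 𝓢(V, ℂ)) :
    Continuous fun x : V => f.compSubConstCLM ℂ x := by
  refine continuous_iff_continuousAt.2 fun a => ?_
  have h1 : Filter.Tendsto (fun x : V => x - a) (nhds a) (nhds 0) := by
    have : Continuous fun x : V => x - a := by fun_prop
    simpa using this.tendsto a
  have h2 := (tendsto_translate_zero (f.compSubConstCLM ℂ a)).comp h1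
  refine h2.congr fun x => ?_
  simp only [Function.comp_apply, SchwartzMap.compSubConstCLM_comp, add_sub_cancel]

end Translation

/-! ### Modulations and time-frequency shifts of Schwartz functions -/

section Modulation

variable {V : Type} [NormedAddCommGroup V] [InnerProductSpace ℝ V]

/-- Multiplication by the character `t ↦ exp (2 π i ω · t)`. -/
def modulation (ω : V) : 𝓢(V, ℂ) →L[ℂ] 𝓢(V, ℂ) :=
  SchwartzMap.smulLeftCLM ℂ fun t : V => (𝐞 (inner ℝ ω t) : ℂ)

theorem modulation_apply (ω : V) (f : 𝓢(V, ℂ)) (t : V) :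
    modulation ω f t = (𝐞 (inner ℝ ω t) : ℂ) * f t := by
  rw [modulation, SchwartzMap.smulLeftCLM_apply_apply (hasTemperateGrowth_fourierChar_inner ω)]
  rfl

theorem timeFreqShift_eq (z : V × V) (f : 𝓢(V, ℂ)) :
    timeFreqShift z f = modulation z.2 (f.compSubConstCLM ℂ z.1) := rfl

variable [FiniteDimensional ℝ V] [MeasurableSpace V] [BorelSpace V]

theorem fourier_modulation (ω : V) (f : 𝓢(V, ℂ)) :
    𝓕 (modulation ω f) = (𝓕 f).compSubConstCLM ℂ ω := by
  ext ξ
  rw [SchwartzMap.compSubConstCLM_apply, SchwartzMap.fourier_coe, SchwartzMap.fourier_coe,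
    Real.fourier_eq, Real.fourier_eq]
  refine integral_congr_ae (Filter.Eventually.of_forall fun t => ?_)
  simp only [modulation_apply, Circle.smul_def, smul_eq_mul]
  rw [← mul_assoc, ← Circle.coe_mul, ← AddChar.map_add_eq_mul, inner_sub_right,
    real_inner_comm t ω]
  congr 3
  ring

/-- The Fourier transform conjugates modulation into translation, so the seminorm bounds and the
continuity in ω carry over without differentiating the character. -/
theorem modulation_eq (ω : V) (f : 𝓢(V, ℂ)) :
    modulation ω f = 𝓕⁻ ((𝓕 f).compSubConstCLM ℂ ω) := by
  rw [← fourier_modulation, FourierTransform.fourierInv_fourier_eq]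

theorem exists_seminorm_bound_modulation (p : Seminorm ℂ 𝓢(V, ℂ)) (hp : Continuous p) :
    ∃ (N : ℕ) (q : Seminorm ℂ 𝓢(V, ℂ)), Continuous q ∧
      ∀ (ω : V) (f : 𝓢(V, ℂ)), p (modulation ω f) ≤ (1 + ‖ω‖) ^ N * q f := by
  let T : 𝓢(V, ℂ) →L[ℂ] 𝓢(V, ℂ) := FourierTransform.fourierCLM ℂ 𝓢(V, ℂ)
  let T' : 𝓢(V, ℂ) →L[ℂ] 𝓢(V, ℂ) := FourierTransform.fourierInvCLM ℂ 𝓢(V, ℂ)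
  obtain ⟨N, q, hq, h⟩ := exists_seminorm_bound_translate (p.comp T'.toLinearMap)
    (hp.comp T'.continuous)
  refine ⟨N, q.comp T.toLinearMap, hq.comp T.continuous, fun ω f => ?_⟩
  rw [modulation_eq]
  exact h ω (𝓕 f)

theorem continuous_modulation (f : 𝓢(V, ℂ)) : Continuous fun ω : V => modulation ω f := by
  simp_rw [modulation_eq]
  exact (FourierTransform.fourierInvCLM ℂ 𝓢(V, ℂ)).continuous.comp (continuous_translate (𝓕 f))

theorem exists_seminorm_bound_timeFreqShift (p : Seminorm ℂ 𝓢(V, ℂ)) (hp : Continuous p) :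
    ∃ (N : ℕ) (q : Seminorm ℂ 𝓢(V, ℂ)), Continuous q ∧
      ∀ (z : V × V) (f : 𝓢(V, ℂ)), p (timeFreqShift z f) ≤ (1 + ‖z‖) ^ N * q f := by
  obtain ⟨N₁, q₁, hq₁, h₁⟩ := exists_seminorm_bound_modulation p hp
  obtain ⟨N₂, q₂, hq₂, h₂⟩ := exists_seminorm_bound_translate q₁ hq₁
  refine ⟨N₁ + N₂, q₂, hq₂, fun z f => ?_⟩
  rw [timeFreqShift_eq, pow_add, mul_assoc]
  refine (h₁ z.2 _).trans ?_
  have := h₂ z.1 f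
  have hz1 : ‖z.1‖ ≤ ‖z‖ := norm_fst_le z
  have hz2 : ‖z.2‖ ≤ ‖z‖ := norm_snd_le z
  have hq : 0 ≤ q₂ f := apply_nonneg _ _
  calc (1 + ‖z.2‖) ^ N₁ * q₁ (f.compSubConstCLM ℂ z.1)
      ≤ (1 + ‖z‖) ^ N₁ * ((1 + ‖z.1‖) ^ N₂ * q₂ f) := by gcongr
    _ ≤ _ := by gcongr

/-- Separate continuity would not suffice. The difference of two translates is modulated by a
variable frequency, and it still tends to 0 because the modulation bound is locally uniform in ω. -/
theorem continuous_timeFreqShift (f : 𝓢(V, ℂ)) :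
    Continuous fun z : V × V => timeFreqShift z f := by
  refine continuous_iff_continuousAt.2 fun a => ?_
  have h2 : Filter.Tendsto (fun z : V × V => modulation z.2 (f.compSubConstCLM ℂ a.1)) (nhds a)
      (nhds (timeFreqShift a f)) :=
    ((continuous_modulation _).comp continuous_snd).tendsto a
  have h1 : Filter.Tendsto (fun z : V × V => modulation z.2
      (f.compSubConstCLM ℂ z.1 - f.compSubConstCLM ℂ a.1)) (nhds a) (nhds 0) := by
    rw [(schwartz_withSeminorms ℂ V ℂ).tendsto_nhds]
    intro i ε hε
    obtain ⟨N, q, hq, h⟩ := exists_seminorm_bound_modulation (schwartzSeminormFamily ℂ V ℂ i)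
      ((schwartz_withSeminorms ℂ V ℂ).continuous_seminorm i)
    have hc : Continuous fun z : V × V => (1 + ‖z.2‖) ^ N *
        q (f.compSubConstCLM ℂ z.1 - f.compSubConstCLM ℂ a.1) :=
      Continuous.mul (by fun_prop)
        (hq.comp (((continuous_translate f).comp continuous_fst).sub continuous_const))
    have ht := hc.tendsto a
    simp only [sub_self, map_zero, mul_zero] at ht
    filter_upwards [ht.eventually (gt_mem_nhds hε)] with z hz
    rw [sub_zero]
    exact (h _ _).trans_lt hz
  have h3 := h1.add h2
  rw [zero_add] at h3
  refine h3.congr fun z => ?_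
  rw [map_sub, timeFreqShift_eq, sub_add_cancel]

end Modulation

end

section

/-! ### Tempered distributions under Schwartz-valued integrals -/

section SchwartzIntegral

variable {V : Type} [NormedAddCommGroup V] [NormedSpace ℝ V]
  {Z : Type} [TopologicalSpace Z] [SecondCountableTopology Z] [MeasurableSpace Z]
  [OpensMeasurableSpace Z] {μ : Measure Z}

/-- Differentiation under the integral sign, dominated by the seminorm of order (0, 1), which does
not depend on the point. -/
theorem fderiv_eq_integral {F : Type} [NormedAddCommGroup F] [NormedSpace ℝ F]
    {Φ : Z → 𝓢(V, F)} (hΦ : Continuous Φ)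
    (hint : ∀ k n, Integrable (fun z => SchwartzMap.seminorm ℝ k n (Φ z)) μ)
    {φ : 𝓢(V, F)} (hφ : ∀ x, φ x = ∫ z, Φ z x ∂μ) (x : V) :
    fderiv ℝ φ x = ∫ z, fderiv ℝ (Φ z) x ∂μ := by
  have hev {G : Type} [NormedAddCommGroup G] [NormedSpace ℝ G] (x : V) :
      Continuous fun f : 𝓢(V, G) => f x := by
    have := (SchwartzMap.toBoundedContinuousFunctionCLM ℝ V G).continuous
    exact (BoundedContinuousFunction.evalCLM ℝ x).continuous.comp this
  have hm (x : V) : AEStronglyMeasurable (fun z => Φ z x) μ :=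
    ((hev x).comp hΦ).aestronglyMeasurable
  have hm' : AEStronglyMeasurable (fun z => fderiv ℝ (Φ z) x) μ :=
    ((hev x).comp ((SchwartzMap.fderivCLM ℝ V F).continuous.comp hΦ)).aestronglyMeasurable
  have hb (z : Z) (x : V) : ‖fderiv ℝ (Φ z) x‖ ≤ SchwartzMap.seminorm ℝ 0 1 (Φ z) := by
    have := SchwartzMap.norm_iteratedFDeriv_le_seminorm ℝ (Φ z) 1 x
    rwa [norm_iteratedFDeriv_one] at this
  have key := hasFDerivAt_integral_of_dominated_of_fderiv_le (𝕜 := ℝ) (μ := μ)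
    (F := fun x z => Φ z x) (F' := fun x z => fderiv ℝ (Φ z) x) (x₀ := x)
    (bound := fun z => SchwartzMap.seminorm ℝ 0 1 (Φ z)) Filter.univ_mem
    (Filter.Eventually.of_forall hm)
    ((hint 0 0).mono' (hm x) (Filter.Eventually.of_forall fun z =>
      SchwartzMap.norm_le_seminorm ℝ (Φ z) x)) hm'
    (Filter.Eventually.of_forall fun z x _ => hb z x) (hint 0 1)
    (Filter.Eventually.of_forall fun z x _ => (Φ z).hasFDerivAt x)
  rw [← key.fderiv]
  congr 1
  exact funext hφ

/-- The target space is quantified inside the induction because the inductive hypothesis is applied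
to derivatives, whose values lie in `V →L[ℝ] F`. -/
theorem iteratedFDeriv_eq_integral (n : ℕ) : ∀ {F : Type} [NormedAddCommGroup F]
    [NormedSpace ℝ F] {Φ : Z → 𝓢(V, F)}, Continuous Φ →
    (∀ k n, Integrable (fun z => SchwartzMap.seminorm ℝ k n (Φ z)) μ) →
    ∀ {φ : 𝓢(V, F)}, (∀ x, φ x = ∫ z, Φ z x ∂μ) →
    ∀ x, iteratedFDeriv ℝ n φ x = ∫ z, iteratedFDeriv ℝ n (Φ z) x ∂μ := by
  induction n with
  | zero =>
    intro F _ _ Φ _ _ φ hφ x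
    have h (f : V → F) : iteratedFDeriv ℝ 0 f x =
        (continuousMultilinearCurryFin0 ℝ V F).symm (f x) := rfl
    simp_rw [h]
    rw [hφ]
    -- A continuous linear equivalence commutes with the integral without any integrability
    -- condition.
    exact (((continuousMultilinearCurryFin0 ℝ V F).symm.toContinuousLinearEquiv).integral_comp_comm
      _).symm
  | succ n ih =>
    intro F _ _ Φ hΦ hint φ hφ x
    let D := SchwartzMap.fderivCLM ℝ V F
    have h1 (k m : ℕ) : Integrable (fun z => SchwartzMap.seminorm ℝ k m (D (Φ z))) μ := by
      refine (hint k (m + 1)).mono' ?_ (Filter.Eventually.of_forall fun z => ?_)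
      · exact (((schwartz_withSeminorms ℝ V (V →L[ℝ] F)).continuous_seminorm (k, m)).comp
          (D.continuous.comp hΦ)).aestronglyMeasurable
      · rw [Real.norm_of_nonneg (apply_nonneg _ _)]
        refine SchwartzMap.seminorm_le_bound ℝ k m _ (apply_nonneg _ _) fun y => ?_
        have e : (D (Φ z) : V → V →L[ℝ] F) = fderiv ℝ (Φ z) := rfl
        rw [e, norm_iteratedFDeriv_fderiv]
        exact SchwartzMap.le_seminorm ℝ k (m + 1) (Φ z) y
    have h2 := ih (D.continuous.comp hΦ) h1 (φ := D φ) (fderiv_eq_integral hΦ hint hφ) x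
    have h (f : V → F) : iteratedFDeriv ℝ (n + 1) f x =
        (continuousMultilinearCurryRightEquiv' ℝ n V F).symm
          (iteratedFDeriv ℝ n (fderiv ℝ f) x) := by
      rw [iteratedFDeriv_succ_eq_comp_right]
      rfl
    simp_rw [h]
    refine (congrArg (continuousMultilinearCurryRightEquiv' ℝ n V F).symm h2).trans ?_
    exact (((continuousMultilinearCurryRightEquiv' ℝ n V
      F).symm.toContinuousLinearEquiv).integral_comp_comm
        fun z => iteratedFDeriv ℝ n (fderiv ℝ (Φ z)) x).symm

/-- Bounded continuous functions with values in the `n`-linear forms on `V`. -/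
def BoundedForms (V : Type) [NormedAddCommGroup V] [NormedSpace ℝ V] (n : ℕ) : Type :=
  BoundedContinuousFunction V (V [×n]→L[ℝ] ℂ)

instance (n : ℕ) : NormedAddCommGroup (BoundedForms V n) :=
  inferInstanceAs (NormedAddCommGroup (BoundedContinuousFunction V (V [×n]→L[ℝ] ℂ)))

instance (n : ℕ) : NormedSpace ℂ (BoundedForms V n) :=
  inferInstanceAs (NormedSpace ℂ (BoundedContinuousFunction V (V [×n]→L[ℝ] ℂ)))

instance (n : ℕ) : CompleteSpace (BoundedForms V n) :=
  inferInstanceAs (CompleteSpace (BoundedContinuousFunction V (V [×n]→L[ℝ] ℂ)))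

/-- Evaluation of a bounded family of forms at a point. -/
def BoundedForms.eval {n : ℕ} (x : V) : BoundedForms V n →L[ℂ] (V [×n]→L[ℝ] ℂ) :=
  BoundedContinuousFunction.evalCLM ℂ x

theorem BoundedForms.ext {n : ℕ} {f g : BoundedForms V n}
    (h : ∀ x, BoundedForms.eval x f = BoundedForms.eval x g) : f = g :=
  BoundedContinuousFunction.ext h

theorem BoundedForms.norm_eval_le {n : ℕ} (f : BoundedForms V n) (x : V) :
    ‖BoundedForms.eval x f‖ ≤ ‖f‖ :=
  BoundedContinuousFunction.norm_coe_le_norm (α := V) (β := V [×n]→L[ℝ] ℂ) f x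

/-- The weighted derivative `x ↦ ‖x‖ ^ k • D^n f x` as a bounded continuous function. -/
def weightedDerivAux (k n : ℕ) (f : 𝓢(V, ℂ)) : BoundedForms V n :=
  BoundedContinuousFunction.ofNormedAddCommGroup (α := V) (β := V [×n]→L[ℝ] ℂ)
    (fun x => ((‖x‖ ^ k : ℝ) : ℂ) • iteratedFDeriv ℝ n f x)
    ((Complex.continuous_ofReal.comp (continuous_norm.pow k)).smul
      ((f.smooth n).continuous_iteratedFDeriv le_rfl))
    (SchwartzMap.seminorm ℂ k n f) fun x => by
      rw [norm_smul, Complex.norm_real, Real.norm_of_nonneg (by positivity)]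
      exact SchwartzMap.le_seminorm ℂ k n f x

theorem eval_weightedDerivAux (k n : ℕ) (f : 𝓢(V, ℂ)) (x : V) :
    BoundedForms.eval x (weightedDerivAux k n f) =
      ((‖x‖ ^ k : ℝ) : ℂ) • iteratedFDeriv ℝ n f x := rfl

theorem norm_weightedDerivAux_le (k n : ℕ) (f : 𝓢(V, ℂ)) :
    ‖weightedDerivAux k n f‖ ≤ SchwartzMap.seminorm ℂ k n f :=
  BoundedContinuousFunction.norm_ofNormedAddCommGroup_le (α := V) (β := V [×n]→L[ℝ] ℂ) _
    (apply_nonneg _ _) _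

variable (V) in
/-- The weighted derivative `x ↦ ‖x‖ ^ k • D^n f x`, as a continuous linear map. -/
def weightedDeriv (k n : ℕ) : 𝓢(V, ℂ) →L[ℂ] BoundedForms V n :=
  SchwartzMap.mkCLMtoNormedSpace (weightedDerivAux k n)
    (fun f g => BoundedForms.ext fun x => by
      rw [map_add, eval_weightedDerivAux, eval_weightedDerivAux, eval_weightedDerivAux]
      refine (congrArg (((‖x‖ ^ k : ℝ) : ℂ) • ·) ?_).trans
        (smul_add ((‖x‖ ^ k : ℝ) : ℂ) (iteratedFDeriv ℝ n f x) (iteratedFDeriv ℝ n g x))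
      exact iteratedFDeriv_add_apply (f.contDiffAt n) (g.contDiffAt n))
    (fun c f => BoundedForms.ext fun x => by
      rw [RingHom.id_apply, map_smul, eval_weightedDerivAux, eval_weightedDerivAux, smul_comm c]
      congr 1
      exact iteratedFDeriv_const_smul_apply (f.contDiffAt n))
    ⟨{(k, n)}, 1, zero_le_one, fun f => by
      rw [Finset.sup_singleton, one_mul]
      exact norm_weightedDerivAux_le k n f⟩

theorem eval_weightedDeriv (k n : ℕ) (f : 𝓢(V, ℂ)) (x : V) :
    BoundedForms.eval x (weightedDeriv V k n f) =
      ((‖x‖ ^ k : ℝ) : ℂ) • iteratedFDeriv ℝ n f x := rfl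

theorem norm_weightedDeriv_le (k n : ℕ) (f : 𝓢(V, ℂ)) :
    ‖weightedDeriv V k n f‖ ≤ SchwartzMap.seminorm ℂ k n f := norm_weightedDerivAux_le k n f

/-- Together with `norm_weightedDeriv_le` this realizes each Schwartz seminorm as the norm of an
image in a Banach space. -/
theorem seminorm_le_norm_weightedDeriv (k n : ℕ) (f : 𝓢(V, ℂ)) :
    SchwartzMap.seminorm ℂ k n f ≤ ‖weightedDeriv V k n f‖ := by
  refine SchwartzMap.seminorm_le_bound ℂ k n f (norm_nonneg _) fun x => ?_
  have := (weightedDeriv V k n f).norm_eval_le x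
  rwa [eval_weightedDeriv, norm_smul, Complex.norm_real,
    Real.norm_of_nonneg (by positivity)] at this

/-- A continuous linear functional on the Schwartz space factors through finitely many weighted
derivatives. -/
theorem exists_factor_weightedDeriv (u : 𝓢(V, ℂ) →L[ℂ] ℂ) : ∃ (s : Finset (ℕ × ℕ))
    (U : (∀ i : s, BoundedForms V i.1.2) →L[ℂ] ℂ),
    ∀ f, u f = U fun i => weightedDeriv V i.1.1 i.1.2 f := by
  let p : Seminorm ℂ 𝓢(V, ℂ) := (normSeminorm ℂ ℂ).comp u.toLinearMap
  have hp : Continuous p := continuous_norm.comp u.continuous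
  obtain ⟨s, C, -, hC⟩ := Seminorm.bound_of_continuous (schwartz_withSeminorms ℂ V ℂ) p hp
  let T : 𝓢(V, ℂ) →ₗ[ℂ] (∀ i : s, BoundedForms V i.1.2) :=
    (ContinuousLinearMap.pi fun i : s => weightedDeriv V i.1.1 i.1.2).toLinearMap
  have hT (f : 𝓢(V, ℂ)) : ‖u f‖ ≤ C * ‖T f‖ := by
    refine (hC f).trans ?_
    rw [smul_apply, NNReal.smul_def, smul_eq_mul]
    refine mul_le_mul_of_nonneg_left ?_ C.2
    refine Seminorm.finset_sup_apply_le (norm_nonneg _) fun i hi => ?_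
    exact (seminorm_le_norm_weightedDeriv i.1 i.2 f).trans (norm_le_pi_norm (T f) ⟨i, hi⟩)
  -- T need not be injective (s may be empty), but the bound `hT` lets u descend to the range of T.
  have hker : LinearMap.ker T ≤ LinearMap.ker u.toLinearMap := fun f hf => by
    have := hT f
    rw [LinearMap.mem_ker.1 hf, norm_zero (E := ∀ i : s, BoundedForms V i.1.2), mul_zero] at this
    exact norm_le_zero_iff.1 this
  let u' : LinearMap.range T →ₗ[ℂ] ℂ :=
    (LinearMap.ker T).liftQ u.toLinearMap hker ∘ₗ T.quotKerEquivRange.symm.toLinearMap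
  have hu' (f : 𝓢(V, ℂ)) : u' ⟨T f, LinearMap.mem_range_self T f⟩ = u f := by
    have : T.quotKerEquivRange.symm ⟨T f, LinearMap.mem_range_self T f⟩ =
        Submodule.Quotient.mk f :=
      (LinearEquiv.symm_apply_eq _).2 rfl
    simp only [u', LinearMap.comp_apply, LinearEquiv.coe_coe, this]
    rfl
  -- Hahn–Banach extends the functional from the range of T to the whole product.
  obtain ⟨U, hU, -⟩ := exists_extension_norm_eq (LinearMap.range T)
    (u'.mkContinuous C fun ⟨y, f, hf⟩ => by
      subst hf
      rw [hu']
      exact hT f)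
  refine ⟨s, U, fun f => ?_⟩
  rw [← hu']
  exact (hU ⟨T f, LinearMap.mem_range_self T f⟩).symm

/-- Tempered distributions commute with absolutely convergent Schwartz-valued integrals. -/
theorem apply_eq_integral (u : 𝓢(V, ℂ) →L[ℂ] ℂ) {Φ : Z → 𝓢(V, ℂ)} (hΦ : Continuous Φ)
    (hint : ∀ k n, Integrable (fun z => SchwartzMap.seminorm ℂ k n (Φ z)) μ)
    {φ : 𝓢(V, ℂ)} (hφ : ∀ x, φ x = ∫ z, Φ z x ∂μ) :
    Integrable (fun z => u (Φ z)) μ ∧ u φ = ∫ z, u (Φ z) ∂μ := by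
  obtain ⟨s, U, hU⟩ := exists_factor_weightedDeriv u
  let T : 𝓢(V, ℂ) →L[ℂ] (∀ i : s, BoundedForms V i.1.2) :=
    ContinuousLinearMap.pi fun i : s => weightedDeriv V i.1.1 i.1.2
  -- The Schwartz space is not normable in general, so the Bochner integral is formed after T, in a
  -- finite product of Banach spaces.
  have hTi : Integrable (fun z => T (Φ z)) μ := by
    refine (integrable_finsetSum s (f := fun i z => SchwartzMap.seminorm ℂ i.1 i.2 (Φ z))
      fun i _ => hint i.1 i.2).mono' ?_ (Filter.Eventually.of_forall fun z => ?_)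
    · exact (T.continuous.comp hΦ).aestronglyMeasurable
    · refine (pi_norm_le_iff_of_nonneg (Finset.sum_nonneg fun _ _ => apply_nonneg _ _)).2
        fun i => ?_
      exact (norm_weightedDeriv_le i.1.1 i.1.2 (Φ z)).trans
        (Finset.single_le_sum (f := fun i : ℕ × ℕ => SchwartzMap.seminorm ℂ i.1 i.2 (Φ z))
          (fun _ _ => apply_nonneg _ _) i.2)
  -- Evaluation at each point and in each component reduces this to differentiation under the
  -- integral.
  have hTφ : T φ = ∫ z, T (Φ z) ∂μ := by
    funext i
    refine BoundedForms.ext fun x => ?_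
    let P : (∀ i : s, BoundedForms V i.1.2) →L[ℂ] (V [×i.1.2]→L[ℝ] ℂ) :=
      (BoundedForms.eval x).comp (ContinuousLinearMap.proj i)
    have h1 : P (∫ z, T (Φ z) ∂μ) = ∫ z, P (T (Φ z)) ∂μ :=
      (ContinuousLinearMap.integral_comp_comm P hTi).symm
    refine Eq.trans ?_ h1.symm
    have h2 (f : 𝓢(V, ℂ)) : P (T f) = ((‖x‖ ^ i.1.1 : ℝ) : ℂ) • iteratedFDeriv ℝ i.1.2 f x := rfl
    simp_rw [h2]
    rw [integral_smul]
    exact congrArg (((‖x‖ ^ i.1.1 : ℝ) : ℂ) • ·) (iteratedFDeriv_eq_integral i.1.2 hΦ hint hφ x)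
  have hU' (f : 𝓢(V, ℂ)) : u f = U (T f) := hU f
  simp_rw [hU']
  exact ⟨U.integrable_comp hTi, by rw [hTφ, ContinuousLinearMap.integral_comp_comm _ hTi]⟩

end SchwartzIntegral

end

/-! ### The short-time Fourier transform: continuity, decay, inversion -/

section

variable {ι : Type} [Fintype ι]

instance : (volume : Measure (Euc ι × Euc ι)).IsAddHaarMeasure :=
  inferInstanceAs ((volume : Measure (Euc ι)).prod volume).IsAddHaarMeasure

theorem conj_gaussian (t : Euc ι) : (starRingEnd ℂ) (gaussian ι t) = gaussian ι t := by
  rw [gaussian_apply, Complex.conj_ofReal]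

theorem conj_fourierChar (s : ℝ) : (starRingEnd ℂ) (𝐞 s : ℂ) = (𝐞 (-s) : ℂ) := by
  rw [AddChar.map_neg_eq_inv, Circle.coe_inv_eq_conj]

/-- The window is real, so conjugation only reverses the frequency; the reflections (x, -ω) below
come from here. -/
theorem conjSchwartz_timeFreqShift_gaussian (z : Euc ι × Euc ι) :
    conjSchwartz (timeFreqShift z (gaussian ι)) = timeFreqShift (z.1, -z.2) (gaussian ι) := by
  ext t
  rw [conjSchwartz_apply, timeFreqShift_apply, timeFreqShift_apply, map_mul, conj_gaussian,
    conj_fourierChar, inner_neg_left]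

theorem stft_eq (u : 𝓢'(Euc ι, ℂ)) (z : Euc ι × Euc ι) :
    stft u z = u (timeFreqShift (z.1, -z.2) (gaussian ι)) := by
  rw [stft, conjSchwartz_timeFreqShift_gaussian]

theorem continuous_stft (u : 𝓢'(Euc ι, ℂ)) : Continuous (stft u) := by
  have h : stft u = fun z => u (timeFreqShift (z.1, -z.2) (gaussian ι)) := funext (stft_eq u)
  rw [h]
  have hu : Continuous u := by fun_prop
  exact hu.comp ((continuous_timeFreqShift _).comp (by fun_prop))

/-- The tempered distribution attached to a Schwartz function. -/
def schwartzDist (φ : 𝓢(Euc ι, ℂ)) : 𝓢'(Euc ι, ℂ) :=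
  SchwartzMap.toTemperedDistributionCLM (Euc ι) ℂ volume φ

theorem stft_schwartzDist (φ : 𝓢(Euc ι, ℂ)) : stft (schwartzDist φ) = stftFun φ := by
  ext z
  refine (SchwartzMap.toTemperedDistributionCLM_apply_apply volume φ _).trans ?_
  refine integral_congr_ae (Filter.Eventually.of_forall fun t => ?_)
  simp only [conjSchwartz_apply, smul_eq_mul, mul_comm]

theorem continuous_stftFun (φ : 𝓢(Euc ι, ℂ)) : Continuous (stftFun φ) := by
  rw [← stft_schwartzDist]
  exact continuous_stft _

/-! ### Decay -/

/-- The weight at x splits into weights at t and t - x. The first is absorbed by a seminorm of φ,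
the second by the weighted L¹ norm of ψ. -/
theorem integral_norm_mul_translate_le (ψ : 𝓢(Euc ι, ℂ)) (N : ℕ) :
    ∃ q : Seminorm ℂ 𝓢(Euc ι, ℂ), Continuous q ∧ ∀ (φ : 𝓢(Euc ι, ℂ)) (x : Euc ι),
      (1 + ‖x‖) ^ N * ∫ t, ‖φ t‖ * ‖ψ (t - x)‖ ≤ q φ := by
  obtain ⟨q, hq, h⟩ := exists_seminorm_one_add (V := Euc ι) N 0
  have hψ : Integrable (fun t => (1 + ‖t‖) ^ N * ‖ψ t‖) := by
    let M := (volume : Measure (Euc ι)).integrablePower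
    obtain ⟨p, hp, h'⟩ := exists_seminorm_one_add (V := Euc ι) (N + M) 0
    refine ((Measure.integrable_pow_neg_integrablePower (volume : Measure (Euc ι))).const_mul
      (p ψ)).mono' ?_ (Filter.Eventually.of_forall fun t => ?_)
    · exact Continuous.aestronglyMeasurable (by fun_prop)
    · have h1 := h' ψ t
      rw [norm_iteratedFDeriv_zero, pow_add] at h1
      rw [Real.norm_of_nonneg (by positivity), Real.rpow_neg (by positivity), Real.rpow_natCast,
        ← div_eq_mul_inv, le_div_iff₀ (by positivity)]
      calc _ = (1 + ‖t‖) ^ N * (1 + ‖t‖) ^ M * ‖ψ t‖ := by ring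
        _ ≤ _ := h1
  let C : NNReal := ⟨∫ t, (1 + ‖t‖) ^ N * ‖ψ t‖, integral_nonneg fun t => by positivity⟩
  have hC : (C : ℝ) = ∫ t, (1 + ‖t‖) ^ N * ‖ψ t‖ := rfl
  refine ⟨C • q, ?_, fun φ x => ?_⟩
  · exact (continuous_const.mul hq : Continuous fun φ => (C : ℝ) * q φ)
  · rw [smul_apply, NNReal.smul_def, smul_eq_mul, hC, mul_comm _ (q φ),
      ← integral_sub_right_eq_self (fun t => (1 + ‖t‖) ^ N * ‖ψ t‖) x, ← integral_const_mul,
      ← integral_const_mul]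
    refine integral_mono_of_nonneg (Filter.Eventually.of_forall fun t => by positivity)
      ((hψ.comp_sub_right x).const_mul _) (Filter.Eventually.of_forall fun t => ?_)
    have h1 := h φ t
    rw [norm_iteratedFDeriv_zero] at h1
    have h2 := one_add_norm_le_mul t x
    rw [norm_sub_rev] at h2
    calc (1 + ‖x‖) ^ N * (‖φ t‖ * ‖ψ (t - x)‖)
        ≤ ((1 + ‖t‖) * (1 + ‖t - x‖)) ^ N * (‖φ t‖ * ‖ψ (t - x)‖) := by gcongr
      _ = ((1 + ‖t‖) ^ N * ‖φ t‖) * ((1 + ‖t - x‖) ^ N * ‖ψ (t - x)‖) := by rw [mul_pow]; ring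
      _ ≤ _ := mul_le_mul_of_nonneg_right h1 (by positivity)

theorem norm_fourier_translate (f : 𝓢(Euc ι, ℂ)) (x ξ : Euc ι) :
    ‖𝓕 (f.compSubConstCLM ℂ x) ξ‖ = ‖𝓕 f ξ‖ := by
  have h := VectorFourier.fourierIntegral_comp_add_right Real.fourierChar
    (volume : Measure (Euc ι)) (innerₗ (Euc ι)) f (-x)
  have h' := congrArg norm (congrFun h ξ)
  rw [Circle.norm_smul] at h'
  rw [SchwartzMap.fourier_coe, SchwartzMap.fourier_coe]
  simp only [← sub_eq_add_neg] at h'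
  exact h'

theorem norm_timeFreqShift (z : Euc ι × Euc ι) (f : 𝓢(Euc ι, ℂ)) (t : Euc ι) :
    ‖timeFreqShift z f t‖ = ‖f (t - z.1)‖ := by
  rw [timeFreqShift_apply, norm_mul, Circle.norm_coe, one_mul]

theorem norm_stftFun_le (φ : 𝓢(Euc ι, ℂ)) (z : Euc ι × Euc ι) :
    ‖stftFun φ z‖ ≤ ∫ t, ‖φ t‖ * ‖gaussian ι (t - z.1)‖ := by
  refine (norm_integral_le_integral_norm _).trans_eq (integral_congr_ae
    (Filter.Eventually.of_forall fun t => ?_))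
  simp only [norm_mul, RCLike.norm_conj, norm_timeFreqShift]

/-- By Parseval. On the Fourier side the modulation becomes a translation and the translation only a
phase, so this bound controls decay in ω as `norm_stftFun_le` controls decay in x. -/
theorem norm_stftFun_le_fourier (φ : 𝓢(Euc ι, ℂ)) (z : Euc ι × Euc ι) :
    ‖stftFun φ z‖ ≤ ∫ ξ, ‖𝓕 φ ξ‖ * ‖𝓕 (gaussian ι) (ξ - z.2)‖ := by
  have h := SchwartzMap.integral_inner_fourier_fourier (timeFreqShift z (gaussian ι)) φ
  simp only [RCLike.inner_apply] at h
  rw [stftFun, ← h]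
  refine (norm_integral_le_integral_norm _).trans_eq (integral_congr_ae
    (Filter.Eventually.of_forall fun ξ => ?_))
  simp only [norm_mul, RCLike.norm_conj, timeFreqShift_eq, fourier_modulation,
    SchwartzMap.compSubConstCLM_apply, norm_fourier_translate]

/-- The short-time Fourier transform of a Schwartz function decays rapidly. -/
theorem exists_seminorm_stftFun (N : ℕ) : ∃ q : Seminorm ℂ 𝓢(Euc ι, ℂ), Continuous q ∧
    ∀ (φ : 𝓢(Euc ι, ℂ)) (z : Euc ι × Euc ι), (1 + ‖z‖) ^ N * ‖stftFun φ z‖ ≤ q φ := by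
  obtain ⟨q₁, hq₁, h₁⟩ := integral_norm_mul_translate_le (gaussian ι) N
  obtain ⟨q₂, hq₂, h₂⟩ := integral_norm_mul_translate_le (𝓕 (gaussian ι)) N
  let T : 𝓢(Euc ι, ℂ) →L[ℂ] 𝓢(Euc ι, ℂ) := FourierTransform.fourierCLM ℂ 𝓢(Euc ι, ℂ)
  refine ⟨q₁ + q₂.comp T.toLinearMap, hq₁.add (hq₂.comp T.continuous), fun φ z => ?_⟩
  have e : (q₁ + q₂.comp T.toLinearMap) φ = q₁ φ + q₂ (𝓕 φ) := rfl
  rw [e]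
  have hp₁ : 0 ≤ q₁ φ := apply_nonneg _ _
  have hp₂ : 0 ≤ q₂ (𝓕 φ) := apply_nonneg _ _
  -- The norm of z is the larger of the two component norms, and that component selects the bound to
  -- use.
  rcases max_cases ‖z.1‖ ‖z.2‖ with h | h
  · have hz : ‖z‖ = ‖z.1‖ := h.1
    rw [hz]
    refine le_trans ?_ ((h₁ φ z.1).trans (le_add_of_nonneg_right hp₂))
    gcongr
    exact norm_stftFun_le φ z
  · have hz : ‖z‖ = ‖z.2‖ := h.1
    rw [hz]
    refine le_trans ?_ ((h₂ (𝓕 φ) z.2).trans (le_add_of_nonneg_left hp₁))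
    gcongr
    exact norm_stftFun_le_fourier φ z

/-- The additional M powers of decay pay for integrability over phase space. -/
theorem exists_seminorm_integrable_stftFun (N : ℕ) :
    ∃ q : Seminorm ℂ 𝓢(Euc ι, ℂ), Continuous q ∧ ∀ (φ : 𝓢(Euc ι, ℂ)),
      Integrable (fun z => (1 + ‖z‖) ^ N * ‖stftFun φ z‖) ∧
        ∫ z, (1 + ‖z‖) ^ N * ‖stftFun φ z‖ ≤ q φ := by
  let M := (volume : Measure (Euc ι × Euc ι)).integrablePower
  obtain ⟨q, hq, h⟩ := exists_seminorm_stftFun (ι := ι) (N + M)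
  let C : NNReal := ⟨∫ z : Euc ι × Euc ι, (1 + ‖z‖) ^ (-(M : ℝ)),
    integral_nonneg fun t => by positivity⟩
  have hC : (C : ℝ) = ∫ z : Euc ι × Euc ι, (1 + ‖z‖) ^ (-(M : ℝ)) := rfl
  have hI : Integrable fun z : Euc ι × Euc ι => (1 + ‖z‖) ^ (-(M : ℝ)) :=
    Measure.integrable_pow_neg_integrablePower volume
  have hb (φ : 𝓢(Euc ι, ℂ)) (z : Euc ι × Euc ι) :
      (1 + ‖z‖) ^ N * ‖stftFun φ z‖ ≤ (1 + ‖z‖) ^ (-(M : ℝ)) * q φ := by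
    rw [mul_comm _ (q φ), Real.rpow_neg (by positivity), Real.rpow_natCast, ← div_eq_mul_inv,
      le_div_iff₀ (by positivity)]
    refine le_trans (le_of_eq ?_) (h φ z)
    rw [pow_add]
    ring
  have hint (φ : 𝓢(Euc ι, ℂ)) : Integrable (fun z => (1 + ‖z‖) ^ N * ‖stftFun φ z‖) := by
    refine (hI.mul_const (q φ)).mono' ?_ (Filter.Eventually.of_forall fun z => ?_)
    · have := continuous_stftFun φ
      exact Continuous.aestronglyMeasurable (by fun_prop)
    · rw [Real.norm_of_nonneg (by positivity)]
      exact hb φ z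
  refine ⟨C • q, ?_, fun φ => ⟨hint φ, ?_⟩⟩
  · exact (continuous_const.mul hq : Continuous fun φ => (C : ℝ) * q φ)
  · rw [smul_apply, NNReal.smul_def, smul_eq_mul, hC, ← integral_mul_const]
    exact integral_mono (hint φ) (hI.mul_const _) (hb φ)

theorem integrable_stftFun (φ : 𝓢(Euc ι, ℂ)) : Integrable (stftFun φ) := by
  obtain ⟨q, -, h⟩ := exists_seminorm_integrable_stftFun (ι := ι) 0
  have := (h φ).1
  simp only [pow_zero, one_mul] at this
  exact (integrable_norm_iff (continuous_stftFun φ).aestronglyMeasurable).1 this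

/-! ### Inversion -/

/-- The factor 2 ^ (n / 4) is chosen for this; it is why the inversion formula carries no constant.
-/
theorem integral_gaussian_sq : ∫ t, gaussian ι t * gaussian ι t = 1 := by
  have h (t : Euc ι) : gaussian ι t * gaussian ι t =
      (((2 : ℝ) ^ ((Fintype.card ι : ℝ) / 2) * Real.exp (-(2 * Real.pi) * ‖t‖ ^ 2) : ℝ) : ℂ) := by
    rw [gaussian_apply, ← Complex.ofReal_mul]
    congr 1
    have h1 : (2 : ℝ) ^ ((Fintype.card ι : ℝ) / 2) =
        2 ^ ((Fintype.card ι : ℝ) / 4) * 2 ^ ((Fintype.card ι : ℝ) / 4) := by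
      rw [← Real.rpow_add two_pos]
      congr 1
      ring
    have h2 : Real.exp (-(2 * Real.pi) * ‖t‖ ^ 2) =
        Real.exp (-Real.pi * ‖t‖ ^ 2) * Real.exp (-Real.pi * ‖t‖ ^ 2) := by
      rw [← Real.exp_add]
      congr 1
      ring
    rw [h1, h2]
    ring
  simp_rw [h]
  rw [integral_complex_ofReal, integral_const_mul,
    GaussianFourier.integral_rexp_neg_mul_sq_norm (by positivity), finrank_euclideanSpace,
    div_mul_cancel_right₀ Real.pi_ne_zero, ← Real.mul_rpow (by norm_num) (by norm_num)]
  simp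

/-- The product of `φ` with the translate by `x` of the Gaussian window. -/
def mulTranslate (φ : 𝓢(Euc ι, ℂ)) (x : Euc ι) : 𝓢(Euc ι, ℂ) :=
  SchwartzMap.smulLeftCLM ℂ ((gaussian ι).compSubConstCLM ℂ x) φ

theorem mulTranslate_apply (φ : 𝓢(Euc ι, ℂ)) (x t : Euc ι) :
    mulTranslate φ x t = gaussian ι (t - x) * φ t := by
  rw [mulTranslate, SchwartzMap.smulLeftCLM_apply_apply (SchwartzMap.hasTemperateGrowth _)]
  rfl

theorem stftFun_eq_fourier (φ : 𝓢(Euc ι, ℂ)) (x ω : Euc ι) :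
    stftFun φ (x, ω) = 𝓕 (mulTranslate φ x) ω := by
  rw [stftFun, SchwartzMap.fourier_coe, Real.fourier_eq]
  refine integral_congr_ae (Filter.Eventually.of_forall fun t => ?_)
  simp only [timeFreqShift_apply, mulTranslate_apply, map_mul, conj_gaussian, conj_fourierChar,
    Circle.smul_def, smul_eq_mul, real_inner_comm ω t]
  ring

theorem norm_gaussian_le (t : Euc ι) :
    ‖gaussian ι t‖ ≤ SchwartzMap.seminorm ℂ 0 0 (gaussian ι) :=
  SchwartzMap.norm_le_seminorm ℂ _ t

theorem continuous_timeFreqShift_apply (ψ : 𝓢(Euc ι, ℂ)) :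
    Continuous fun p : (Euc ι × Euc ι) × Euc ι => timeFreqShift p.1 ψ p.2 := by
  have h (p : (Euc ι × Euc ι) × Euc ι) : timeFreqShift p.1 ψ p.2 =
      (𝐞 (inner ℝ p.1.2 p.2) : ℂ) * ψ (p.2 - p.1.1) := timeFreqShift_apply _ _ _
  simp_rw [h]
  have h1 : Continuous fun p : (Euc ι × Euc ι) × Euc ι => (𝐞 (inner ℝ p.1.2 p.2) : ℂ) :=
    continuous_subtype_val.comp (Real.continuous_fourierChar.comp (by fun_prop))
  have := ψ.continuous
  fun_prop

/-- Pointwise inversion of the short-time Fourier transform of a Schwartz function. -/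
theorem integral_stftFun_mul_timeFreqShift (φ : 𝓢(Euc ι, ℂ)) (t : Euc ι) :
    ∫ z, stftFun φ z * timeFreqShift z (gaussian ι) t = φ t := by
  have hI : Integrable fun z => stftFun φ z * timeFreqShift z (gaussian ι) t := by
    refine (integrable_stftFun φ).mul_bdd (c := SchwartzMap.seminorm ℂ 0 0 (gaussian ι)) ?_
      (Filter.Eventually.of_forall fun z => ?_)
    · exact ((continuous_timeFreqShift_apply (gaussian ι)).comp
        (Continuous.prodMk_left t)).aestronglyMeasurable
    · rw [norm_timeFreqShift]
      exact norm_gaussian_le _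
  rw [Measure.volume_eq_prod] at hI ⊢
  rw [integral_prod _ hI]
  -- For fixed x the integral over ω is Fourier inversion for `mulTranslate φ x`. The shift supplies
  -- the second Gaussian factor, and the integral over x is then the normalization.
  have h1 (x : Euc ι) : ∫ ω, stftFun φ (x, ω) * timeFreqShift (x, ω) (gaussian ι) t =
      φ t * (gaussian ι (t - x) * gaussian ι (t - x)) := by
    have e (ω : Euc ι) : stftFun φ (x, ω) * timeFreqShift (x, ω) (gaussian ι) t =
        ((𝐞 (inner ℝ ω t) : ℂ) * 𝓕 (mulTranslate φ x) ω) * gaussian ι (t - x) := by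
      rw [stftFun_eq_fourier, timeFreqShift_apply]
      ring
    simp_rw [e]
    rw [integral_mul_const]
    have h2 : ∫ ω, (𝐞 (inner ℝ ω t) : ℂ) * 𝓕 (mulTranslate φ x) ω = mulTranslate φ x t := by
      have h3 : 𝓕⁻ (𝓕 (mulTranslate φ x)) = mulTranslate φ x :=
        FourierTransform.fourierInv_fourier_eq _
      rw [← DFunLike.congr_fun h3 t, SchwartzMap.fourierInv_coe, Real.fourierInv_eq]
      rfl
    rw [h2, mulTranslate_apply]
    ring
  simp_rw [h1]
  rw [integral_const_mul, integral_sub_left_eq_self (fun x => gaussian ι x * gaussian ι x) volume t,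
    integral_gaussian_sq, mul_one]

/-- The inversion formula for tempered distributions, tested against Schwartz functions. -/
theorem apply_conjSchwartz_eq_integral (u : 𝓢'(Euc ι, ℂ)) (φ : 𝓢(Euc ι, ℂ)) :
    Integrable (fun z => stft u z * (starRingEnd ℂ) (stftFun φ z)) ∧
      u (conjSchwartz φ) = ∫ z, stft u z * (starRingEnd ℂ) (stftFun φ z) := by
  -- The conjugate of the pointwise inversion formula represents `conjSchwartz φ` as the integral of
  -- these Schwartz functions.
  let Φ : Euc ι × Euc ι → 𝓢(Euc ι, ℂ) := fun z =>
    (starRingEnd ℂ) (stftFun φ z) • timeFreqShift (z.1, -z.2) (gaussian ι)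
  have hs : Continuous fun z : Euc ι × Euc ι => timeFreqShift (z.1, -z.2) (gaussian ι) :=
    (continuous_timeFreqShift _).comp (by fun_prop)
  have hc : Continuous fun z => (starRingEnd ℂ) (stftFun φ z) :=
    Complex.continuous_conj.comp (continuous_stftFun φ)
  have hΦ : Continuous Φ := hc.smul hs
  have key := apply_eq_integral (μ := volume) (u : 𝓢(Euc ι, ℂ) →L[ℂ] ℂ) hΦ
    (fun k n => ?_) (φ := conjSchwartz φ) (fun t => ?_)
  · have e (z : Euc ι × Euc ι) : (u : 𝓢(Euc ι, ℂ) →L[ℂ] ℂ) (Φ z) =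
        stft u z * (starRingEnd ℂ) (stftFun φ z) := by
      rw [map_smul, stft_eq, smul_eq_mul, mul_comm]
    have e' := funext e
    exact e' ▸ key
  -- The seminorms of the shifts grow polynomially, which the rapid decay of V_γ φ outweighs.
  · have hsn := (schwartz_withSeminorms ℂ (Euc ι) ℂ).continuous_seminorm (k, n)
    obtain ⟨N, q, -, hq⟩ := exists_seminorm_bound_timeFreqShift _ hsn
    obtain ⟨_, _, hN⟩ := exists_seminorm_integrable_stftFun (ι := ι) N
    refine ((hN φ).1.mul_const (q (gaussian ι))).mono' (hsn.comp hΦ).aestronglyMeasurable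
      (Filter.Eventually.of_forall fun z => ?_)
    rw [Real.norm_of_nonneg (apply_nonneg _ _)]
    simp only [Φ, map_smul_eq_mul, RCLike.norm_conj]
    have h1 := hq (z.1, -z.2) (gaussian ι)
    have h2 : ‖((z.1, -z.2) : Euc ι × Euc ι)‖ = ‖z‖ := by simp [Prod.norm_def]
    rw [h2] at h1
    calc _ ≤ ‖stftFun φ z‖ * ((1 + ‖z‖) ^ N * q (gaussian ι)) := by gcongr; exact h1
      _ = _ := by ring
  · rw [conjSchwartz_apply, ← integral_stftFun_mul_timeFreqShift φ t, ← integral_conj]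
    refine integral_congr_ae (Filter.Eventually.of_forall fun z => ?_)
    simp only [Φ, smul_apply, map_mul, ← conjSchwartz_timeFreqShift_gaussian, smul_eq_mul]
    rfl

theorem conjSchwartz_conjSchwartz (φ : 𝓢(Euc ι, ℂ)) : conjSchwartz (conjSchwartz φ) = φ := by
  ext t
  simp only [conjSchwartz_apply, Complex.conj_conj]

theorem stft_injective : Function.Injective (stft : 𝓢'(Euc ι, ℂ) → _) := fun u v h => by
  ext φ
  rw [← conjSchwartz_conjSchwartz φ, (apply_conjSchwartz_eq_integral u _).2,
    (apply_conjSchwartz_eq_integral v _).2, h]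

end

/-! ### Gaussian superpositions, elements of M¹, and the adjoint transform -/

section

/-- The integrability hypothesis of the Fubini exchanges below: an L¹ density against a kernel with
uniformly bounded L¹ sections. -/
theorem integrable_mul_kernel {X Y : Type} [MeasurableSpace X] [MeasurableSpace Y]
    {μ : Measure X} {ν : Measure Y} [SFinite μ] [SFinite ν] {a : X → ℂ} {k : X → Y → ℂ} {C : ℝ}
    (ha : Integrable a μ)
    (hk : AEStronglyMeasurable (fun p : X × Y => k p.1 p.2) (μ.prod ν))
    (hki : ∀ x, Integrable (k x) ν) (hkb : ∀ x, ∫ y, ‖k x y‖ ∂ν ≤ C) :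
    Integrable (fun p : X × Y => a p.1 * k p.1 p.2) (μ.prod ν) := by
  have hm : AEStronglyMeasurable (fun p : X × Y => a p.1 * k p.1 p.2) (μ.prod ν) :=
    ha.aestronglyMeasurable.comp_fst.mul hk
  refine (integrable_prod_iff hm).2 ⟨Filter.Eventually.of_forall fun x => (hki x).const_mul (a x), ?_⟩
  refine (ha.norm.mul_const C).mono' hm.norm.integral_prod_right'
    (Filter.Eventually.of_forall fun x => ?_)
  simp only [norm_mul, integral_const_mul, norm_norm]
  rw [Real.norm_of_nonneg (integral_nonneg fun y => norm_nonneg _)]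
  exact mul_le_mul_of_nonneg_left (hkb x) (norm_nonneg _)

variable {ι : Type} [Fintype ι]

theorem integrable_conj {X : Type} [MeasurableSpace X] {μ : Measure X} {f : X → ℂ}
    (hf : Integrable f μ) : Integrable (fun x => (starRingEnd ℂ) (f x)) μ :=
  (Complex.conjCLE : ℂ →L[ℝ] ℂ).integrable_comp hf

/-! ### Covariance of the short-time Fourier transform -/

theorem fourierChar_mul (x y : ℝ) : (𝐞 x : ℂ) * (𝐞 y : ℂ) = (𝐞 (x + y) : ℂ) := by
  rw [AddChar.map_add_eq_mul, Circle.coe_mul]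

/-- Substituting t + a.1 leaves a phase independent of t. In absolute value the transform is merely
translated, so its sup and L¹ norms do not depend on a. -/
theorem stftFun_timeFreqShift (a w : Euc ι × Euc ι) (ψ : 𝓢(Euc ι, ℂ)) :
    stftFun (timeFreqShift a ψ) w =
      (𝐞 (inner ℝ (a.2 - w.2) a.1) : ℂ) * stftFun ψ (w - a) := by
  rw [stftFun, stftFun, ← integral_add_right_eq_self _ a.1, ← integral_const_mul]
  refine integral_congr_ae (Filter.Eventually.of_forall fun t => ?_)
  have e₁ : t + a.1 - w.1 = t - (w - a).1 := by rw [Prod.fst_sub]; abel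
  have e₂ : (𝐞 (inner ℝ a.2 (t + a.1)) : ℂ) * (𝐞 (-inner ℝ w.2 (t + a.1)) : ℂ) =
      (𝐞 (inner ℝ (a.2 - w.2) a.1) : ℂ) * (𝐞 (-inner ℝ (w - a).2 t) : ℂ) := by
    rw [fourierChar_mul, fourierChar_mul, Prod.snd_sub, inner_sub_left, inner_sub_left,
      inner_add_right, inner_add_right]
    congr 2
    ring
  simp only [timeFreqShift_apply, map_mul, conj_fourierChar, add_sub_cancel_right, e₁]
  linear_combination (ψ t * (starRingEnd ℂ) (gaussian ι (t - (w - a).1))) * e₂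

theorem norm_stftFun_timeFreqShift (a w : Euc ι × Euc ι) (ψ : 𝓢(Euc ι, ℂ)) :
    ‖stftFun (timeFreqShift a ψ) w‖ = ‖stftFun ψ (w - a)‖ := by
  rw [stftFun_timeFreqShift, norm_mul, Circle.norm_coe, one_mul]

theorem integral_norm_stftFun_timeFreqShift (a : Euc ι × Euc ι) (ψ : 𝓢(Euc ι, ℂ)) :
    ∫ w, ‖stftFun (timeFreqShift a ψ) w‖ = ∫ w, ‖stftFun ψ w‖ := by
  simp_rw [norm_stftFun_timeFreqShift]
  exact integral_sub_right_eq_self (fun w => ‖stftFun ψ w‖) a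

theorem continuous_stftFun_timeFreqShift (ψ : 𝓢(Euc ι, ℂ)) :
    Continuous fun p : (Euc ι × Euc ι) × (Euc ι × Euc ι) =>
      stftFun (timeFreqShift p.1 ψ) p.2 := by
  simp_rw [stftFun_timeFreqShift]
  have h1 : Continuous fun p : (Euc ι × Euc ι) × (Euc ι × Euc ι) =>
      (𝐞 (inner ℝ (p.1.2 - p.2.2) p.1.1) : ℂ) :=
    continuous_subtype_val.comp (Real.continuous_fourierChar.comp (by fun_prop))
  have := continuous_stftFun ψ
  fun_prop

theorem stftFun_timeFreqShift_gaussian_symm (a w : Euc ι × Euc ι) :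
    stftFun (timeFreqShift a (gaussian ι)) w =
      (starRingEnd ℂ) (stftFun (timeFreqShift w (gaussian ι)) a) := by
  rw [stftFun, stftFun, ← integral_conj]
  refine integral_congr_ae (Filter.Eventually.of_forall fun t => ?_)
  simp only [map_mul, Complex.conj_conj, mul_comm]

/-! ### Elements of `M¹` -/

/-- An element of `M¹` as a tempered distribution. -/
def feichtingerDist (g : feichtinger ι) : 𝓢'(Euc ι, ℂ) :=
  Lp.toTemperedDistributionCLM ℂ volume 2 (g : Lp ℂ 2 (volume : Measure (Euc ι)))

theorem feichtingerDist_apply (g : feichtinger ι) (φ : 𝓢(Euc ι, ℂ)) :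
    feichtingerDist g φ = ∫ t, φ t * toFunction g t :=
  Lp.toTemperedDistribution_apply (g : Lp ℂ 2 (volume : Measure (Euc ι))) φ

theorem stft_feichtingerDist (g : feichtinger ι) :
    stft (feichtingerDist g) = stftFun (toFunction g) := by
  ext z
  rw [stft, feichtingerDist_apply, stftFun]
  refine integral_congr_ae (Filter.Eventually.of_forall fun t => ?_)
  simp only [conjSchwartz_apply, mul_comm]

theorem integrable_stftFun_feichtinger (g : feichtinger ι) :
    Integrable (stftFun (toFunction g)) := by
  rw [← stft_feichtingerDist]
  exact memLp_one_iff_integrable.1 g.2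

theorem toLp_mem_feichtinger (φ : 𝓢(Euc ι, ℂ)) : φ.toLp 2 volume ∈ feichtinger ι := by
  change MemLp (stft (Lp.toTemperedDistributionCLM ℂ volume 2 (φ.toLp 2 volume))) 1 volume
  have h : Lp.toTemperedDistributionCLM ℂ volume 2 (φ.toLp 2 volume) = schwartzDist φ :=
    Lp.toTemperedDistribution_toLp_eq φ
  rw [h, stft_schwartzDist]
  exact memLp_one_iff_integrable.2 (integrable_stftFun φ)

/-- A Schwartz function as an element of `M¹`. -/
def ofSchwartz (φ : 𝓢(Euc ι, ℂ)) : feichtinger ι := ⟨φ.toLp 2 volume, toLp_mem_feichtinger φ⟩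

theorem toFunction_ofSchwartz (φ : 𝓢(Euc ι, ℂ)) : toFunction (ofSchwartz φ) =ᵐ[volume] φ :=
  φ.coeFn_toLp 2 volume

theorem stftFun_congr_ae {F G : Euc ι → ℂ} (h : F =ᵐ[volume] G) : stftFun F = stftFun G := by
  ext z
  refine integral_congr_ae ?_
  filter_upwards [h] with t ht
  rw [ht]

theorem stftFun_ofSchwartz (φ : 𝓢(Euc ι, ℂ)) :
    stftFun (toFunction (ofSchwartz φ)) = stftFun φ :=
  stftFun_congr_ae (toFunction_ofSchwartz φ)

/-- The reproducing formula on `M¹`. -/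
theorem stftFun_eq_integral (g : feichtinger ι) (v : Euc ι × Euc ι) :
    stftFun (toFunction g) v =
      ∫ w, stftFun (toFunction g) w * stftFun (timeFreqShift w (gaussian ι)) v := by
  have h := (apply_conjSchwartz_eq_integral (feichtingerDist g)
    (timeFreqShift v (gaussian ι))).2
  have h1 : feichtingerDist g (conjSchwartz (timeFreqShift v (gaussian ι))) =
      stftFun (toFunction g) v := by rw [← stft_feichtingerDist]; rfl
  rw [h1, stft_feichtingerDist] at h
  simp_rw [stftFun_timeFreqShift_gaussian_symm _ v]
  exact h

theorem integrable_timeFreqShift_mul (w : Euc ι × Euc ι) {H : Euc ι → ℂ} {C : ℝ}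
    (hH : AEStronglyMeasurable H) (hC : ∀ t, ‖H t‖ ≤ C) :
    Integrable (fun t => timeFreqShift w (gaussian ι) t * H t) :=
  (timeFreqShift w (gaussian ι)).integrable.mul_bdd hH (Filter.Eventually.of_forall hC)

/-- The shifts of the Gaussian all have the same L¹ norm, so the inner integrals are bounded
uniformly in w. -/
theorem integrable_synthesis {a : Euc ι × Euc ι → ℂ} (ha : Integrable a) {H : Euc ι → ℂ} {C : ℝ}
    (hH : AEStronglyMeasurable H) (hC : ∀ t, ‖H t‖ ≤ C) :
    Integrable (fun p : (Euc ι × Euc ι) × Euc ι =>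
      a p.1 * (timeFreqShift p.1 (gaussian ι) p.2 * H p.2)) (volume.prod volume) := by
  refine integrable_mul_kernel (C := C * ∫ t, ‖gaussian ι t‖) ha ?_
    (fun w => integrable_timeFreqShift_mul w hH hC) fun w => ?_
  · exact (continuous_timeFreqShift_apply (gaussian ι)).aestronglyMeasurable.mul hH.comp_snd
  · rw [← integral_sub_right_eq_self (fun t => ‖gaussian ι t‖) w.1, ← integral_const_mul]
    refine integral_mono (integrable_timeFreqShift_mul w hH hC).norm
      (((gaussian ι).integrable.norm.comp_sub_right w.1).const_mul C) fun t => ?_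
    simp only [norm_mul, norm_timeFreqShift]
    rw [mul_comm]
    exact mul_le_mul_of_nonneg_right (hC t) (norm_nonneg _)

theorem integral_synthesis_mul {a : Euc ι × Euc ι → ℂ} (ha : Integrable a) {H : Euc ι → ℂ} {C : ℝ}
    (hH : AEStronglyMeasurable H) (hC : ∀ t, ‖H t‖ ≤ C) :
    ∫ t, (∫ w, a w * timeFreqShift w (gaussian ι) t) * H t =
      ∫ w, a w * ∫ t, timeFreqShift w (gaussian ι) t * H t := by
  have h := integral_integral_swap
    (f := fun w t => a w * (timeFreqShift w (gaussian ι) t * H t)) (integrable_synthesis ha hH hC)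
  simp_rw [integral_const_mul] at h
  simp_rw [h, ← mul_assoc, integral_mul_const]

theorem integrable_synthesis' {a : Euc ι × Euc ι → ℂ} (ha : Integrable a) :
    Integrable fun t => ∫ w, a w * timeFreqShift w (gaussian ι) t := by
  have h := (integrable_synthesis ha (H := fun _ => 1) (C := 1)
    aestronglyMeasurable_const (by simp)).integral_prod_right
  simpa using h

/-- An element of `M¹` is the superposition of the time-frequency shifts of the Gaussian. -/
theorem toFunction_ae_eq (g : feichtinger ι) : toFunction g =ᵐ[volume] fun t =>
    ∫ w, stftFun (toFunction g) w * timeFreqShift w (gaussian ι) t := by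
  have hg := integrable_stftFun_feichtinger g
  -- Both sides are locally integrable, so testing against real smooth compactly supported h
  -- suffices. Such an h is a Schwartz function equal to its conjugate, to which the inversion
  -- formula for g applies.
  refine ae_eq_of_integral_contDiff_smul_eq
    ((Lp.memLp (g : Lp ℂ 2 (volume : Measure (Euc ι)))).locallyIntegrable one_le_two)
    (integrable_synthesis' hg).locallyIntegrable fun h hsm hcs => ?_
  have hg₁ : HasCompactSupport (Complex.ofRealCLM ∘ h) := hcs.comp_left rfl
  have hg₂ : ContDiff ℝ (⊤ : ℕ∞) (Complex.ofRealCLM ∘ h) := by fun_prop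
  let φ : 𝓢(Euc ι, ℂ) := hg₁.toSchwartzMap hg₂
  have hφ (t : Euc ι) : φ t = h t := rfl
  have hconj : conjSchwartz φ = φ := by
    ext t
    rw [conjSchwartz_apply, hφ, Complex.conj_ofReal]
  have key := (apply_conjSchwartz_eq_integral (feichtingerDist g) φ).2
  rw [hconj, feichtingerDist_apply, stft_feichtingerDist] at key
  have h1 (w : Euc ι × Euc ι) : (starRingEnd ℂ) (stftFun φ w) =
      ∫ t, timeFreqShift w (gaussian ι) t * φ t := by
    rw [stftFun, ← integral_conj]
    refine integral_congr_ae (Filter.Eventually.of_forall fun t => ?_)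
    simp only [map_mul, Complex.conj_conj, hφ, Complex.conj_ofReal, mul_comm]
  simp_rw [h1] at key
  rw [← integral_synthesis_mul hg φ.continuous.aestronglyMeasurable
    (fun t => SchwartzMap.norm_le_seminorm ℂ φ t)] at key
  simp only [hφ] at key
  simp only [Complex.real_smul]
  rw [key]
  simp only [mul_comm]

/-- M¹ ⊂ L¹, because a superposition of Gaussian shifts with L¹ coefficients is integrable. This
makes B_A(g, f) accessible to Fubini. -/
theorem integrable_toFunction (g : feichtinger ι) : Integrable (toFunction g) :=
  (integrable_synthesis' (integrable_stftFun_feichtinger g)).congr (toFunction_ae_eq g).symm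

theorem integral_toFunction_mul (g : feichtinger ι) {H : Euc ι → ℂ} {C : ℝ}
    (hH : AEStronglyMeasurable H) (hC : ∀ t, ‖H t‖ ≤ C) :
    ∫ t, toFunction g t * H t = ∫ w, stftFun (toFunction g) w *
      ∫ t, timeFreqShift w (gaussian ι) t * H t := by
  rw [← integral_synthesis_mul (integrable_stftFun_feichtinger g) hH hC]
  refine integral_congr_ae ?_
  filter_upwards [toFunction_ae_eq g] with t ht
  rw [← ht]

/-! ### The adjoint of the short-time Fourier transform on bounded functions -/

theorem integrable_reflect {X : Type} [NormedAddCommGroup X] {F : Euc ι × Euc ι → X}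
    (hF : Integrable F) : Integrable fun w : Euc ι × Euc ι => F (w.1, -w.2) :=
  ((MeasurePreserving.id volume).prod (Measure.measurePreserving_neg volume)).integrable_comp_of_integrable hF

theorem integral_reflect (F : Euc ι × Euc ι → ℝ) : ∫ w : Euc ι × Euc ι, F (w.1, -w.2) = ∫ w, F w :=
  ((MeasurePreserving.id (volume : Measure (Euc ι))).prod
    (Measure.measurePreserving_neg (volume : Measure (Euc ι)))).integral_comp
    ((MeasurableEquiv.refl _).prodCongr (MeasurableEquiv.neg _)).measurableEmbedding F

theorem stftFun_add (φ ψ : 𝓢(Euc ι, ℂ)) : stftFun (φ + ψ : 𝓢(Euc ι, ℂ)) = stftFun φ + stftFun ψ := by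
  simp_rw [← stft_schwartzDist]
  rw [schwartzDist, map_add]
  rfl

theorem stftFun_smul (c : ℂ) (φ : 𝓢(Euc ι, ℂ)) : stftFun (c • φ : 𝓢(Euc ι, ℂ)) = c • stftFun φ := by
  simp_rw [← stft_schwartzDist]
  rw [schwartzDist, map_smul]
  rfl

theorem integrable_mul_stftFun_reflect {E : Euc ι × Euc ι → ℂ} {C : ℝ}
    (hE : AEStronglyMeasurable E) (hC : ∀ w, ‖E w‖ ≤ C) (φ : 𝓢(Euc ι, ℂ)) :
    Integrable fun w : Euc ι × Euc ι => E w * stftFun φ (w.1, -w.2) :=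
  (integrable_reflect (integrable_stftFun φ)).bdd_mul hE (Filter.Eventually.of_forall hC)

theorem norm_integral_mul_stftFun_reflect_le {E : Euc ι × Euc ι → ℂ} {C : ℝ}
    (hC : ∀ w, ‖E w‖ ≤ C) (φ : 𝓢(Euc ι, ℂ)) :
    ‖∫ w : Euc ι × Euc ι, E w * stftFun φ (w.1, -w.2)‖ ≤ C * ∫ w, ‖stftFun φ w‖ := by
  rw [← integral_reflect, ← integral_const_mul]
  refine norm_integral_le_of_norm_le ((integrable_reflect
    (integrable_stftFun φ).norm).const_mul C) (Filter.Eventually.of_forall fun w => ?_)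
  rw [norm_mul]
  exact mul_le_mul_of_nonneg_right (hC w) (norm_nonneg _)

/-- The tempered distribution `V_γ^* E` for bounded `E`. -/
def adjointStft (E : Euc ι × Euc ι → ℂ) (C : ℝ) (hE : AEStronglyMeasurable E)
    (hC : ∀ w, ‖E w‖ ≤ C) : 𝓢'(Euc ι, ℂ) :=
  ContinuousLinearMap.toPointwiseConvergenceCLM _ _ _ _ <|
    SchwartzMap.mkCLMtoNormedSpace (σ := RingHom.id ℂ)
      -- The action of a distribution is bilinear, and conj (V_γ (conj φ)) (x, ω) = V_γ φ (x, -ω).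
      (fun φ : 𝓢(Euc ι, ℂ) => ∫ w : Euc ι × Euc ι, E w * stftFun φ (w.1, -w.2))
      (fun φ ψ => by
        rw [stftFun_add, ← integral_add (integrable_mul_stftFun_reflect hE hC φ)
          (integrable_mul_stftFun_reflect hE hC ψ)]
        simp only [Pi.add_apply, mul_add])
      (fun c φ => by
        rw [stftFun_smul, RingHom.id_apply, ← integral_smul]
        simp only [Pi.smul_apply, mul_smul_comm])
      (by
        obtain ⟨q, hq, h⟩ := exists_seminorm_integrable_stftFun (ι := ι) 0
        obtain ⟨s, B, -, hB⟩ :=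
          Seminorm.bound_of_continuous (schwartz_withSeminorms ℂ (Euc ι) ℂ) q hq
        have hC0 : 0 ≤ C := (norm_nonneg _).trans (hC 0)
        refine ⟨s, C * B, mul_nonneg hC0 B.2, fun φ => ?_⟩
        refine (norm_integral_mul_stftFun_reflect_le hC φ).trans ?_
        rw [mul_assoc]
        refine mul_le_mul_of_nonneg_left ?_ hC0
        have h1 := (h φ).2
        simp only [pow_zero, one_mul] at h1
        exact h1.trans (hB φ))

theorem adjointStft_apply {E : Euc ι × Euc ι → ℂ} {C : ℝ} (hE : AEStronglyMeasurable E)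
    (hC : ∀ w, ‖E w‖ ≤ C) (φ : 𝓢(Euc ι, ℂ)) : adjointStft E C hE hC φ =
      ∫ w : Euc ι × Euc ι, E w * stftFun φ (w.1, -w.2) := rfl

/-- V_γ of a shifted Gaussian has an L¹ norm independent of the shift; hence V_γ^* maps bounded
functions into M^∞. -/
theorem norm_stft_adjointStft_le {E : Euc ι × Euc ι → ℂ} {C : ℝ} (hE : AEStronglyMeasurable E)
    (hC : ∀ w, ‖E w‖ ≤ C) (z : Euc ι × Euc ι) :
    ‖stft (adjointStft E C hE hC) z‖ ≤ C * ∫ w, ‖stftFun (gaussian ι) w‖ := by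
  rw [stft_eq, adjointStft_apply, ← integral_norm_stftFun_timeFreqShift (z.1, -z.2)]
  exact norm_integral_mul_stftFun_reflect_le hC _

theorem mem_modulationSpace_top {u : 𝓢'(Euc ι, ℂ)} {C : ℝ} (h : ∀ z, ‖stft u z‖ ≤ C) :
    u ∈ modulationSpace ι ⊤ :=
  memLp_top_of_bound (continuous_stft u).aestronglyMeasurable C (Filter.Eventually.of_forall h)

/-- E need not be a short-time Fourier transform itself; V_γ V_γ^* E is its integral against the
Gaussian reproducing kernel. -/
theorem stft_adjointStft {E : Euc ι × Euc ι → ℂ} {C : ℝ} (hE : AEStronglyMeasurable E)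
    (hC : ∀ w, ‖E w‖ ≤ C) (z : Euc ι × Euc ι) : stft (adjointStft E C hE hC) z =
      ∫ w, stftFun (timeFreqShift w (gaussian ι)) z * E w := by
  rw [stft, adjointStft_apply]
  refine integral_congr_ae (Filter.Eventually.of_forall fun w => ?_)
  simp only []
  rw [mul_comm, stftFun_timeFreqShift_gaussian_symm]
  congr 1
  rw [stftFun, stftFun, ← integral_conj]
  refine integral_congr_ae (Filter.Eventually.of_forall fun t => ?_)
  simp only [map_mul, ← conjSchwartz_timeFreqShift_gaussian, conjSchwartz_apply]

/-- After Fubini the reproducing kernel acts on V_γ g instead of E, and the reproducing formula on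
M¹ absorbs it. -/
theorem duality_adjointStft {E : Euc ι × Euc ι → ℂ} {C : ℝ} (hE : AEStronglyMeasurable E)
    (hC : ∀ w, ‖E w‖ ≤ C) (u : modulationSpace ι ⊤)
    (hu : (u : 𝓢'(Euc ι, ℂ)) = adjointStft E C hE hC) (g : feichtinger ι) :
    duality u (toFunction g) = ∫ w, E w * (starRingEnd ℂ) (stftFun (toFunction g) w) := by
  have hc : Continuous fun p : (Euc ι × Euc ι) × (Euc ι × Euc ι) =>
      (starRingEnd ℂ) (stftFun (timeFreqShift p.1 (gaussian ι)) p.2) :=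
    Complex.continuous_conj.comp (continuous_stftFun_timeFreqShift (gaussian ι))
  have hK' (z : Euc ι × Euc ι) : Integrable
      (fun w => (starRingEnd ℂ) (stftFun (timeFreqShift z (gaussian ι)) w)) :=
    integrable_conj (integrable_stftFun (timeFreqShift z (gaussian ι)))
  have hK (z : Euc ι × Euc ι) : Integrable
      (fun w => (starRingEnd ℂ) (stftFun (timeFreqShift z (gaussian ι)) w) * E w) :=
    (hK' z).mul_bdd hE (Filter.Eventually.of_forall hC)
  have hI := integrable_mul_kernel (μ := volume) (ν := volume)
    (a := fun z => (starRingEnd ℂ) (stftFun (toFunction g) z))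
    (k := fun z w => (starRingEnd ℂ) (stftFun (timeFreqShift z (gaussian ι)) w) * E w)
    (C := C * ∫ w, ‖stftFun (gaussian ι) w‖)
    (integrable_conj (integrable_stftFun_feichtinger g))
    (hc.aestronglyMeasurable.mul hE.comp_snd) hK fun z => by
      rw [← integral_norm_stftFun_timeFreqShift z, ← integral_const_mul]
      refine integral_mono (hK z).norm
        ((integrable_stftFun (timeFreqShift z (gaussian ι))).norm.const_mul C) fun w => ?_
      simp only [norm_mul, RCLike.norm_conj]
      rw [mul_comm]
      exact mul_le_mul_of_nonneg_right (hC w) (norm_nonneg _)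
  have hswap := integral_integral_swap (f := fun z w => (starRingEnd ℂ) (stftFun (toFunction g) z) *
    ((starRingEnd ℂ) (stftFun (timeFreqShift z (gaussian ι)) w) * E w)) hI
  have h1 (z : Euc ι × Euc ι) : stft (u : 𝓢'(Euc ι, ℂ)) z *
      (starRingEnd ℂ) (stftFun (toFunction g) z) =
      ∫ w, (starRingEnd ℂ) (stftFun (toFunction g) z) *
        ((starRingEnd ℂ) (stftFun (timeFreqShift z (gaussian ι)) w) * E w) := by
    rw [hu, stft_adjointStft, integral_const_mul, mul_comm]
    simp_rw [stftFun_timeFreqShift_gaussian_symm _ z]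
  have h2 (w : Euc ι × Euc ι) : E w * (starRingEnd ℂ) (stftFun (toFunction g) w) =
      ∫ z, (starRingEnd ℂ) (stftFun (toFunction g) z) *
        ((starRingEnd ℂ) (stftFun (timeFreqShift z (gaussian ι)) w) * E w) := by
    rw [stftFun_eq_integral g w, ← integral_conj, ← integral_const_mul]
    refine integral_congr_ae (Filter.Eventually.of_forall fun z => ?_)
    simp only [map_mul]
    ring
  simp_rw [duality, h1, h2]
  exact hswap

end

/-! ### Phase-space covariance of F₂ T_A and the Wigner kernel -/

section

variable {d : ℕ}

/-! ### Covariance of coordinate changes and of the partial Fourier transform -/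

theorem compCLM_timeFreqShift {V : Type} [NormedAddCommGroup V] [InnerProductSpace ℝ V]
    [CompleteSpace V] (e : V ≃L[ℝ] V) (a : V × V) (F : 𝓢(V, ℂ)) :
    SchwartzMap.compCLMOfContinuousLinearEquiv ℂ e (timeFreqShift a F) =
      timeFreqShift (e.symm a.1, ContinuousLinearMap.adjoint (e : V →L[ℝ] V) a.2)
        (SchwartzMap.compCLMOfContinuousLinearEquiv ℂ e F) := by
  ext t
  simp only [SchwartzMap.compCLMOfContinuousLinearEquiv_apply, Function.comp_apply,
    timeFreqShift_apply, map_sub, ContinuousLinearEquiv.apply_symm_apply,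
    ContinuousLinearMap.adjoint_inner_left, ContinuousLinearEquiv.coe_coe]

theorem inner_toPair (x y x' y' : Euc (Fin d)) :
    inner ℝ (toPair x y) (toPair x' y') = inner ℝ x x' + inner ℝ y y' := by
  simp [toPair, PiLp.inner_apply, Fintype.sum_sum_type]

theorem toPair_sub (x y x' y' : Euc (Fin d)) :
    toPair x y - toPair x' y' = toPair (x - x') (y - y') := by
  simp only [toPair_eq, map_sub]
  abel

/-- The action of the partial Fourier transform on phase space. -/
def partialFourierPhase (a : PhaseSpace d × PhaseSpace d) : PhaseSpace d × PhaseSpace d :=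
  (toPair (fstL d a.1) (sndL d a.2), toPair (fstL d a.2) (-sndL d a.1))

/-- In the second variable F₂ acts by the quarter turn (y, η) ↦ (η, -y); the scalar comes from
reordering translation and modulation. -/
theorem partialFourierCLM_timeFreqShift (a : PhaseSpace d × PhaseSpace d)
    (F : 𝓢(PhaseSpace d, ℂ)) : partialFourierCLM d (timeFreqShift a F) =
      (𝐞 (inner ℝ (sndL d a.1) (sndL d a.2)) : ℂ) •
        timeFreqShift (partialFourierPhase a) (partialFourierCLM d F) := by
  ext z
  rw [smul_apply, smul_eq_mul, timeFreqShift_apply, partialFourierCLM_apply,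
    partialFourierCLM_apply, Real.fourier_eq, Real.fourier_eq,
    ← integral_add_right_eq_self _ (sndL d a.1), ← integral_const_mul, ← integral_const_mul]
  refine integral_congr_ae (Filter.Eventually.of_forall fun y => ?_)
  have e₁ : toPair (fstL d z) (y + sndL d a.1) - a.1 =
      toPair (fstL d (z - (partialFourierPhase a).1)) y := by
    rw [map_sub, partialFourierPhase, fstL_toPair]
    calc toPair (fstL d z) (y + sndL d a.1) - a.1
        = toPair (fstL d z) (y + sndL d a.1) - toPair (fstL d a.1) (sndL d a.1) := by
          rw [toPair_fst_snd]
      _ = _ := by rw [toPair_sub, add_sub_cancel_right]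
  have e₂ : sndL d (z - (partialFourierPhase a).1) = sndL d z - sndL d a.2 := by
    rw [map_sub, partialFourierPhase, sndL_toPair]
  have e₃ : inner ℝ a.2 (toPair (fstL d z) (y + sndL d a.1)) =
      inner ℝ (fstL d a.2) (fstL d z) + inner ℝ (sndL d a.2) (y + sndL d a.1) := by
    conv_lhs => rw [← toPair_fst_snd a.2]
    rw [inner_toPair]
  have e₄ : inner ℝ (partialFourierPhase a).2 z =
      inner ℝ (fstL d a.2) (fstL d z) - inner ℝ (sndL d a.1) (sndL d z) := by
    conv_lhs => rw [← toPair_fst_snd z]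
    rw [partialFourierPhase, inner_toPair, inner_neg_left, sub_eq_add_neg]
  simp only [timeFreqShift_apply, Circle.smul_def, smul_eq_mul, e₁]
  rw [← mul_assoc, ← mul_assoc, ← mul_assoc, fourierChar_mul, fourierChar_mul, fourierChar_mul,
    e₂, e₃, e₄]
  congr 3
  rw [inner_sub_right, inner_add_left, inner_add_right, real_inner_comm y (sndL d a.2),
    real_inner_comm (sndL d a.1) (sndL d a.2)]
  ring

/-- `F₂ T_A` on Schwartz functions. -/
def wignerCLM (A : Matrix.GeneralLinearGroup (Fin d ⊕ Fin d) ℝ) :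
    𝓢(PhaseSpace d, ℂ) →L[ℂ] 𝓢(PhaseSpace d, ℂ) :=
  (partialFourierCLM d).comp (SchwartzMap.compCLMOfContinuousLinearEquiv ℂ (glEquiv A))

/-- Only the continuity of both maps and the modulus 1 of the scalar are needed later, so their
formulas stay hidden. -/
theorem exists_wignerCLM_timeFreqShift (A : Matrix.GeneralLinearGroup (Fin d ⊕ Fin d) ℝ) :
    ∃ (c : PhaseSpace d × PhaseSpace d → ℂ)
      (L : PhaseSpace d × PhaseSpace d → PhaseSpace d × PhaseSpace d),
      Continuous c ∧ Continuous L ∧ (∀ a, ‖c a‖ = 1) ∧ ∀ a F,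
        wignerCLM A (timeFreqShift a F) = c a • timeFreqShift (L a) (wignerCLM A F) := by
  let M : PhaseSpace d × PhaseSpace d → PhaseSpace d × PhaseSpace d := fun a =>
    ((glEquiv A).symm a.1, ContinuousLinearMap.adjoint (glEquiv A : PhaseSpace d →L[ℝ] _) a.2)
  have hM : Continuous M := by fun_prop
  refine ⟨fun a => (𝐞 (inner ℝ (sndL d (M a).1) (sndL d (M a).2)) : ℂ),
    fun a => partialFourierPhase (M a), ?_, ?_, fun a => Circle.norm_coe _, fun a F => ?_⟩
  · exact continuous_subtype_val.comp (Real.continuous_fourierChar.comp (by fun_prop))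
  · simp only [partialFourierPhase, toPair_eq]
    fun_prop
  · rw [wignerCLM, ContinuousLinearMap.comp_apply, compCLM_timeFreqShift,
      partialFourierCLM_timeFreqShift]
    rfl

/-! ### Tensor products of time-frequency shifts of Gaussians -/

/-- The point of `ℝ⁴ᵈ` with `π(w) γ ⊗ conj (π(w') γ) = π(tensorPhase (w, w')) γ`. -/
def tensorPhase (q : (Euc (Fin d) × Euc (Fin d)) × (Euc (Fin d) × Euc (Fin d))) :
    PhaseSpace d × PhaseSpace d :=
  (toPair q.1.1 q.2.1, toPair q.1.2 (-q.2.2))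

theorem continuous_tensorPhase : Continuous (tensorPhase (d := d)) := by
  unfold tensorPhase
  simp only [toPair_eq]
  fun_prop

/-- Because of this, agreement of the coefficients is agreement of short-time Fourier transforms at
every point of ℝ⁴ᵈ. -/
theorem surjective_tensorPhase : Function.Surjective (tensorPhase (d := d)) := fun z =>
  ⟨((fstL d z.1, fstL d z.2), (sndL d z.1, -sndL d z.2)), by simp [tensorPhase]⟩

theorem gaussian_toPair (x y : Euc (Fin d)) :
    gaussian (Fin d ⊕ Fin d) (toPair x y) = gaussian (Fin d) x * gaussian (Fin d) y := by
  rw [gaussian_apply, gaussian_apply, gaussian_apply, ← Complex.ofReal_mul]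
  congr 1
  have h1 : (2 : ℝ) ^ ((Fintype.card (Fin d ⊕ Fin d) : ℝ) / 4) =
      2 ^ ((Fintype.card (Fin d) : ℝ) / 4) * 2 ^ ((Fintype.card (Fin d) : ℝ) / 4) := by
    rw [← Real.rpow_add two_pos, Fintype.card_sum]
    congr 1
    push_cast
    ring
  have h2 : Real.exp (-Real.pi * ‖toPair x y‖ ^ 2) =
      Real.exp (-Real.pi * ‖x‖ ^ 2) * Real.exp (-Real.pi * ‖y‖ ^ 2) := by
    rw [← Real.exp_add, norm_toPair_sq]
    congr 1
    ring
  rw [h1, h2]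
  ring

theorem tensorConj_timeFreqShift_gaussian
    (q : (Euc (Fin d) × Euc (Fin d)) × (Euc (Fin d) × Euc (Fin d))) :
    tensorConj (timeFreqShift q.1 (gaussian (Fin d))) (timeFreqShift q.2 (gaussian (Fin d))) =
      timeFreqShift (tensorPhase q) (gaussian (Fin d ⊕ Fin d)) := by
  ext z
  rw [tensorConj, timeFreqShift_apply, timeFreqShift_apply, timeFreqShift_apply, map_mul,
    conj_gaussian, conj_fourierChar]
  conv_rhs => rw [← toPair_fst_snd z]
  rw [tensorPhase, toPair_sub, gaussian_toPair, inner_toPair, ← fourierChar_mul, inner_neg_left]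
  ring

theorem matrixWigner_timeFreqShift_gaussian (A : Matrix.GeneralLinearGroup (Fin d ⊕ Fin d) ℝ)
    (q : (Euc (Fin d) × Euc (Fin d)) × (Euc (Fin d) × Euc (Fin d))) :
    matrixWigner A (timeFreqShift q.1 (gaussian (Fin d))) (timeFreqShift q.2 (gaussian (Fin d))) =
      wignerCLM A (timeFreqShift (tensorPhase q) (gaussian (Fin d ⊕ Fin d))) := by
  rw [matrixWigner, tensorConj_timeFreqShift_gaussian]
  rfl

/-- The short-time Fourier transform of `B_A (π(w) γ, π(w') γ)`. -/
def wignerKernel (A : Matrix.GeneralLinearGroup (Fin d ⊕ Fin d) ℝ)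
    (q : (Euc (Fin d) × Euc (Fin d)) × (Euc (Fin d) × Euc (Fin d)))
    (z : PhaseSpace d × PhaseSpace d) : ℂ :=
  stftFun (wignerCLM A (timeFreqShift (tensorPhase q) (gaussian (Fin d ⊕ Fin d)))) z

/-- Up to a phase, all the kernels come from shifts of the one Schwartz function F₂ T_A γ, so bounds
for it are uniform in q. -/
theorem exists_wignerKernel_eq (A : Matrix.GeneralLinearGroup (Fin d ⊕ Fin d) ℝ) :
    ∃ (c : (Euc (Fin d) × Euc (Fin d)) × (Euc (Fin d) × Euc (Fin d)) → ℂ)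
      (L : (Euc (Fin d) × Euc (Fin d)) × (Euc (Fin d) × Euc (Fin d)) →
        PhaseSpace d × PhaseSpace d),
      Continuous c ∧ Continuous L ∧ (∀ q, ‖c q‖ = 1) ∧ ∀ q, wignerKernel A q =
        c q • stftFun (timeFreqShift (L q) (wignerCLM A (gaussian (Fin d ⊕ Fin d)))) := by
  obtain ⟨c, L, hc, hL, hn, h⟩ := exists_wignerCLM_timeFreqShift A
  refine ⟨c ∘ tensorPhase, L ∘ tensorPhase, hc.comp continuous_tensorPhase,
    hL.comp continuous_tensorPhase, fun q => hn _, fun q => ?_⟩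
  ext z
  rw [wignerKernel, h, stftFun_smul]
  rfl

theorem continuous_wignerKernel (A : Matrix.GeneralLinearGroup (Fin d ⊕ Fin d) ℝ) :
    Continuous fun p : ((Euc (Fin d) × Euc (Fin d)) × (Euc (Fin d) × Euc (Fin d))) ×
      (PhaseSpace d × PhaseSpace d) => wignerKernel A p.1 p.2 := by
  obtain ⟨c, L, hc, hL, -, h⟩ := exists_wignerKernel_eq A
  have hV := continuous_stftFun_timeFreqShift (wignerCLM A (gaussian (Fin d ⊕ Fin d)))
  obtain ⟨G, hG⟩ : ∃ G : (PhaseSpace d × PhaseSpace d) × (PhaseSpace d × PhaseSpace d) → ℂ,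
      G = fun p => stftFun (timeFreqShift p.1 (wignerCLM A (gaussian (Fin d ⊕ Fin d)))) p.2 :=
    ⟨_, rfl⟩
  rw [← hG] at hV
  have h1 (q : (Euc (Fin d) × Euc (Fin d)) × (Euc (Fin d) × Euc (Fin d)))
      (z : PhaseSpace d × PhaseSpace d) : wignerKernel A q z = c q * G (L q, z) := by
    rw [h, hG]
    rfl
  simp_rw [h1]
  fun_prop

theorem integrable_wignerKernel (A : Matrix.GeneralLinearGroup (Fin d ⊕ Fin d) ℝ)
    (q : (Euc (Fin d) × Euc (Fin d)) × (Euc (Fin d) × Euc (Fin d))) :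
    Integrable (wignerKernel A q) := integrable_stftFun _

theorem exists_integral_norm_wignerKernel_eq (A : Matrix.GeneralLinearGroup (Fin d ⊕ Fin d) ℝ) :
    ∃ C : ℝ, ∀ q, ∫ z, ‖wignerKernel A q z‖ = C := by
  obtain ⟨c, L, -, -, hn, h⟩ := exists_wignerKernel_eq A
  refine ⟨∫ z, ‖stftFun (wignerCLM A (gaussian (Fin d ⊕ Fin d))) z‖, fun q => ?_⟩
  simp_rw [h, Pi.smul_apply, norm_smul, hn, one_mul]
  exact integral_norm_stftFun_timeFreqShift _ _

theorem exists_norm_wignerKernel_le (A : Matrix.GeneralLinearGroup (Fin d ⊕ Fin d) ℝ) :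
    ∃ C : ℝ, ∀ q z, ‖wignerKernel A q z‖ ≤ C := by
  obtain ⟨c, L, -, -, hn, h⟩ := exists_wignerKernel_eq A
  obtain ⟨r, -, hr⟩ := exists_seminorm_stftFun (ι := Fin d ⊕ Fin d) 0
  refine ⟨r (wignerCLM A (gaussian (Fin d ⊕ Fin d))), fun q z => ?_⟩
  simp_rw [h, Pi.smul_apply, norm_smul, hn, one_mul, norm_stftFun_timeFreqShift]
  have := hr (wignerCLM A (gaussian (Fin d ⊕ Fin d))) (z - L q)
  rwa [pow_zero, one_mul] at this

end

/-! ### Expansion of B_A(g, f) in Gaussian shifts for g, f in M¹ -/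

section

variable {d : ℕ}

/-! ### Fubini on phase space -/

/-- `(x, y) ↦ toPair x y` as a measurable equivalence. -/
def pairEquiv (d : ℕ) : Euc (Fin d) × Euc (Fin d) ≃ᵐ PhaseSpace d :=
  (((MeasurableEquiv.toLp 2 (Fin d → ℝ)).symm.prodCongr (MeasurableEquiv.toLp 2 (Fin d → ℝ)).symm).trans
    (MeasurableEquiv.sumPiEquivProdPi fun _ : Fin d ⊕ Fin d => ℝ).symm).trans
    (MeasurableEquiv.toLp 2 (Fin d ⊕ Fin d → ℝ))

theorem pairEquiv_apply (p : Euc (Fin d) × Euc (Fin d)) : pairEquiv d p = toPair p.1 p.2 := by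
  ext i
  cases i <;> rfl

theorem measurePreserving_pairEquiv :
    MeasurePreserving (pairEquiv d) (volume.prod volume) volume := by
  have h1 := EuclideanSpace.volume_preserving_symm_measurableEquiv_toLp (Fin d)
  have h2 := EuclideanSpace.volume_preserving_symm_measurableEquiv_toLp (Fin d ⊕ Fin d)
  exact h2.symm.comp ((volume_measurePreserving_sumPiEquivProdPi_symm
    fun _ : Fin d ⊕ Fin d => ℝ).comp (h1.prod h1))

theorem integral_phaseSpace (F : PhaseSpace d → ℂ) :
    ∫ z, F z = ∫ p : Euc (Fin d) × Euc (Fin d), F (toPair p.1 p.2) ∂(volume.prod volume) := by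
  rw [← measurePreserving_pairEquiv.integral_comp (pairEquiv d).measurableEmbedding]
  simp_rw [pairEquiv_apply]

theorem integrable_phaseSpace {F : PhaseSpace d → ℂ} : Integrable F ↔
    Integrable (fun p : Euc (Fin d) × Euc (Fin d) => F (toPair p.1 p.2))
      (volume.prod volume) := by
  rw [← measurePreserving_pairEquiv.integrable_comp_emb (pairEquiv d).measurableEmbedding]
  simp_rw [Function.comp_def, pairEquiv_apply]

/-- The Jacobian is left anonymous: `stftFun_matrixWigner` eliminates it by evaluation on Gaussian
shifts. -/
theorem integral_comp_glEquiv {ι : Type} [Fintype ι] [DecidableEq ι]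
    (A : Matrix.GeneralLinearGroup ι ℝ) : ∃ c : ℝ, ∀ F : Euc ι → ℂ,
      (Integrable F → Integrable fun z => F (glEquiv A z)) ∧
        ∫ z, F (glEquiv A z) = c * ∫ z, F z := by
  let L : Euc ι →ₗ[ℝ] Euc ι := ((glEquiv A).toLinearEquiv : Euc ι →ₗ[ℝ] Euc ι)
  have hL : LinearMap.det L ≠ 0 := (LinearEquiv.isUnit_det' (glEquiv A).toLinearEquiv).ne_zero
  have hm : Measure.map (glEquiv A) (volume : Measure (Euc ι)) =
      ENNReal.ofReal |(LinearMap.det L)⁻¹| • volume :=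
    Measure.map_linearMap_addHaar_eq_smul_addHaar (volume : Measure (Euc ι)) hL
  have he : MeasurableEmbedding (glEquiv A) :=
    (glEquiv A).toHomeomorph.toMeasurableEquiv.measurableEmbedding
  refine ⟨|(LinearMap.det L)⁻¹|, fun F => ⟨fun hF => ?_, ?_⟩⟩
  · have h1 : Integrable F (Measure.map (glEquiv A) volume) := by
      rw [hm]
      exact hF.smul_measure ENNReal.ofReal_ne_top
    exact he.integrable_map_iff.1 h1
  · rw [← he.integral_map, hm, integral_smul_measure, ENNReal.toReal_ofReal (abs_nonneg _),
      Complex.real_smul]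

theorem aestronglyMeasurable_partialFourier {H : PhaseSpace d → ℂ} (hH : Integrable H) :
    AEStronglyMeasurable (fun p : Euc (Fin d) × Euc (Fin d) => partialFourier H (toPair p.1 p.2))
      (volume.prod volume) := by
  have h1 := (integrable_phaseSpace.1 hH).aestronglyMeasurable
  have h2 : AEStronglyMeasurable (fun r : (Euc (Fin d) × Euc (Fin d)) × Euc (Fin d) =>
      H (toPair r.1.1 r.2)) ((volume.prod volume).prod volume) :=
    h1.comp_quasiMeasurePreserving
      (QuasiMeasurePreserving.prodMap
        (Measure.quasiMeasurePreserving_fst (μ := (volume : Measure (Euc (Fin d))))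
          (ν := (volume : Measure (Euc (Fin d))))) (Measure.QuasiMeasurePreserving.id volume))
  have h3 : Continuous fun r : (Euc (Fin d) × Euc (Fin d)) × Euc (Fin d) =>
      (𝐞 (-inner ℝ r.2 r.1.2) : ℂ) :=
    continuous_subtype_val.comp (Real.continuous_fourierChar.comp (by fun_prop))
  have h4 := (h3.aestronglyMeasurable.mul h2).integral_prod_right'
  refine h4.congr (Filter.Eventually.of_forall fun p => ?_)
  exact (Real.fourier_eq (fun y => H (toPair p.1 y)) p.2).symm

theorem norm_fourier_le (h : Euc (Fin d) → ℂ) (ω : Euc (Fin d)) : ‖𝓕 h ω‖ ≤ ∫ y, ‖h y‖ :=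
  VectorFourier.norm_fourierIntegral_le_integral_norm _ _ _ _ _

/-- The multiplication formula for the Fourier transform on almost every section. Fubini applies
because |F₂ H(x, ω)| ≤ ∫ |H(x, y)| dy and ψ(x, ω) has an integrable bound in ω uniform in x. -/
theorem integral_partialFourier_mul {H : PhaseSpace d → ℂ} (hH : Integrable H)
    (ψ : 𝓢(PhaseSpace d, ℂ)) :
    ∫ z, partialFourier H z * ψ z = ∫ z, H z * partialFourierCLM d ψ z := by
  have hH' := integrable_phaseSpace.1 hH
  obtain ⟨b, hb, hψ⟩ := exists_integrable_bound ψ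
  have hcont : Continuous fun p : Euc (Fin d) × Euc (Fin d) => toPair p.1 p.2 := by
    simp_rw [toPair_eq]
    fun_prop
  have hI : Integrable (fun p : Euc (Fin d) × Euc (Fin d) =>
      partialFourier H (toPair p.1 p.2) * ψ (toPair p.1 p.2)) (volume.prod volume) := by
    refine (hH'.norm.integral_prod_left.mul_prod hb).mono'
      ((aestronglyMeasurable_partialFourier hH).mul
        (ψ.continuous.comp hcont).aestronglyMeasurable)
      (Filter.Eventually.of_forall fun p => ?_)
    rw [norm_mul]
    exact mul_le_mul (norm_fourier_le _ _) (hψ p.1 p.2) (norm_nonneg _)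
      (integral_nonneg fun _ => norm_nonneg _)
  have hI' : Integrable (fun p : Euc (Fin d) × Euc (Fin d) =>
      H (toPair p.1 p.2) * partialFourierCLM d ψ (toPair p.1 p.2)) (volume.prod volume) := by
    refine hH'.mul_bdd (c := SchwartzMap.seminorm ℂ 0 0 (partialFourierCLM d ψ))
      ((partialFourierCLM d ψ).continuous.comp hcont).aestronglyMeasurable
      (Filter.Eventually.of_forall fun p => SchwartzMap.norm_le_seminorm ℂ _ _)
  rw [integral_phaseSpace, integral_phaseSpace, integral_prod _ hI, integral_prod _ hI']
  refine integral_congr_ae ?_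
  filter_upwards [hH'.prod_right_ae] with x hx
  have h := VectorFourier.integral_fourierIntegral_smul_eq_flip (L := innerₗ (Euc (Fin d)))
    Real.continuous_fourierChar continuous_inner hx ((sectionCLM x ψ).integrable (μ := volume))
  rw [flip_innerₗ] at h
  exact h

/-! ### Matrix-Wigner distributions of integrable functions -/

/-- The sesquilinear form `∫ G (s) conj (F (t)) θ (s, t) ds dt`. -/
def sesqForm (θ : Euc (Fin d) × Euc (Fin d) → ℂ) (G F : Euc (Fin d) → ℂ) : ℂ :=
  ∫ p : Euc (Fin d) × Euc (Fin d), G p.1 * (starRingEnd ℂ) (F p.2) * θ p ∂(volume.prod volume)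

/-- F₂ and T_A are transposed onto the window. What remains is a form bounded on L¹ × L¹ with a
continuous bounded weight, in which each argument can be expanded separately. -/
theorem exists_stftFun_matrixWigner (A : Matrix.GeneralLinearGroup (Fin d ⊕ Fin d) ℝ) :
    ∃ (c : ℂ) (θ : PhaseSpace d × PhaseSpace d → Euc (Fin d) × Euc (Fin d) → ℂ),
      (∀ z, Continuous (θ z)) ∧ (∀ z, ∃ C, ∀ p, ‖θ z p‖ ≤ C) ∧
      ∀ G F : Euc (Fin d) → ℂ, Integrable G → Integrable F → ∀ z,
        stftFun (matrixWigner A G F) z = c * sesqForm (θ z) G F := by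
  obtain ⟨c, hc⟩ := integral_comp_glEquiv A
  let Θ : PhaseSpace d × PhaseSpace d → 𝓢(PhaseSpace d, ℂ) := fun z =>
    SchwartzMap.compCLMOfContinuousLinearEquiv ℂ (glEquiv A).symm
      (partialFourierCLM d (conjSchwartz (timeFreqShift z (gaussian (Fin d ⊕ Fin d)))))
  have hcont : Continuous fun p : Euc (Fin d) × Euc (Fin d) => toPair p.1 p.2 := by
    simp_rw [toPair_eq]
    fun_prop
  refine ⟨c, fun z p => Θ z (toPair p.1 p.2), fun z => (Θ z).continuous.comp hcont,
    fun z => ⟨_, fun p => SchwartzMap.norm_le_seminorm ℂ (Θ z) _⟩, fun G F hG hF z => ?_⟩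
  have hT : Integrable (tensorConj G F) :=
    integrable_phaseSpace.2 (hG.mul_prod (integrable_conj hF))
  have hH : Integrable (coordTransform A (tensorConj G F)) := (hc _).1 hT
  have h1 : stftFun (matrixWigner A G F) z = ∫ t, coordTransform A (tensorConj G F) t *
      partialFourierCLM d (conjSchwartz (timeFreqShift z (gaussian (Fin d ⊕ Fin d)))) t :=
    integral_partialFourier_mul hH
      (conjSchwartz (timeFreqShift z (gaussian (Fin d ⊕ Fin d))))
  have h2 (t : PhaseSpace d) : coordTransform A (tensorConj G F) t *
      partialFourierCLM d (conjSchwartz (timeFreqShift z (gaussian (Fin d ⊕ Fin d)))) t =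
      tensorConj G F (glEquiv A t) * Θ z (glEquiv A t) := by
    simp only [Θ, SchwartzMap.compCLMOfContinuousLinearEquiv_apply, Function.comp_apply,
      ContinuousLinearEquiv.symm_apply_apply]
    rfl
  simp_rw [h1, h2]
  rw [(hc fun p => tensorConj G F p * Θ z p).2, integral_phaseSpace]
  rfl

section SesqForm

variable {θ : Euc (Fin d) × Euc (Fin d) → ℂ} {C : ℝ}

theorem integrable_sesqForm (hθ : Continuous θ) (hC : ∀ p, ‖θ p‖ ≤ C) {G F : Euc (Fin d) → ℂ}
    (hG : Integrable G) (hF : Integrable F) :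
    Integrable (fun p : Euc (Fin d) × Euc (Fin d) => G p.1 * (starRingEnd ℂ) (F p.2) * θ p)
      (volume.prod volume) :=
  (hG.mul_prod (integrable_conj hF)).mul_bdd hθ.aestronglyMeasurable
    (Filter.Eventually.of_forall hC)

theorem sesqForm_eq (hθ : Continuous θ) (hC : ∀ p, ‖θ p‖ ≤ C) {G F : Euc (Fin d) → ℂ}
    (hG : Integrable G) (hF : Integrable F) :
    sesqForm θ G F = ∫ s, G s * ∫ t, (starRingEnd ℂ) (F t) * θ (s, t) := by
  rw [sesqForm, integral_prod _ (integrable_sesqForm hθ hC hG hF)]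
  simp_rw [mul_assoc, integral_const_mul]

/-- Reduces the expansion of the second argument to that of the first. -/
theorem sesqForm_swap (θ : Euc (Fin d) × Euc (Fin d) → ℂ) (G F : Euc (Fin d) → ℂ) :
    sesqForm θ G F = (starRingEnd ℂ) (sesqForm (fun p => (starRingEnd ℂ) (θ p.swap)) F G) := by
  rw [sesqForm, sesqForm, ← integral_conj, ← integral_prod_swap]
  refine integral_congr_ae (Filter.Eventually.of_forall fun p => ?_)
  simp only [map_mul, Complex.conj_conj, Prod.fst_swap, Prod.snd_swap]
  ring

/-- Integrating out t leaves a bounded measurable function of s, against which the superposition for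
g may be integrated. -/
theorem sesqForm_toFunction_left (hθ : Continuous θ) (hC : ∀ p, ‖θ p‖ ≤ C)
    (g : feichtinger (Fin d)) {F : Euc (Fin d) → ℂ} (hF : Integrable F) :
    sesqForm θ (toFunction g) F = ∫ w, stftFun (toFunction g) w *
      sesqForm θ (timeFreqShift w (gaussian (Fin d))) F := by
  have hm : AEStronglyMeasurable (fun s => ∫ t, (starRingEnd ℂ) (F t) * θ (s, t)) :=
    ((integrable_conj hF).aestronglyMeasurable.comp_snd.mul
      hθ.aestronglyMeasurable).integral_prod_right'
  have hb (s : Euc (Fin d)) : ‖∫ t, (starRingEnd ℂ) (F t) * θ (s, t)‖ ≤ ∫ t, ‖F t‖ * C := by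
    refine norm_integral_le_of_norm_le (hF.norm.mul_const C)
      (Filter.Eventually.of_forall fun t => ?_)
    rw [norm_mul, RCLike.norm_conj]
    exact mul_le_mul_of_nonneg_left (hC _) (norm_nonneg _)
  rw [sesqForm_eq hθ hC (integrable_toFunction g) hF, integral_toFunction_mul g hm hb]
  simp_rw [sesqForm_eq hθ hC (timeFreqShift _ (gaussian (Fin d))).integrable hF]

theorem sesqForm_toFunction_right (hθ : Continuous θ) (hC : ∀ p, ‖θ p‖ ≤ C)
    (f : feichtinger (Fin d)) {G : Euc (Fin d) → ℂ} (hG : Integrable G) :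
    sesqForm θ G (toFunction f) = ∫ w, (starRingEnd ℂ) (stftFun (toFunction f) w) *
      sesqForm θ G (timeFreqShift w (gaussian (Fin d))) := by
  have hθ' : Continuous fun p : Euc (Fin d) × Euc (Fin d) => (starRingEnd ℂ) (θ p.swap) :=
    Complex.continuous_conj.comp (hθ.comp continuous_swap)
  have hC' (p : Euc (Fin d) × Euc (Fin d)) : ‖(starRingEnd ℂ) (θ p.swap)‖ ≤ C := by
    rw [RCLike.norm_conj]
    exact hC _
  rw [sesqForm_swap, sesqForm_toFunction_left hθ' hC' f hG, ← integral_conj]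
  refine integral_congr_ae (Filter.Eventually.of_forall fun w => ?_)
  simp only [map_mul]
  rw [← sesqForm_swap]

end SesqForm

theorem sesqForm_congr_ae (θ : Euc (Fin d) × Euc (Fin d) → ℂ) {G G' F F' : Euc (Fin d) → ℂ}
    (hG : G =ᵐ[volume] G') (hF : F =ᵐ[volume] F') : sesqForm θ G F = sesqForm θ G' F' := by
  refine integral_congr_ae ?_
  filter_upwards [Measure.quasiMeasurePreserving_fst.ae_eq_comp hG,
    Measure.quasiMeasurePreserving_snd.ae_eq_comp hF] with p h1 h2
  simp only [Function.comp_apply] at h1 h2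
  rw [h1, h2]

/-- Elements of M¹ are a.e. classes, whereas B_A is formed from representatives; the transform of
B_A does not see the choice. -/
theorem stftFun_matrixWigner_ofSchwartz (A : Matrix.GeneralLinearGroup (Fin d ⊕ Fin d) ℝ)
    (φ ψ : 𝓢(Euc (Fin d), ℂ)) :
    stftFun (matrixWigner A (toFunction (ofSchwartz φ)) (toFunction (ofSchwartz ψ))) =
      stftFun (matrixWigner A φ ψ) := by
  obtain ⟨c, θ, -, -, h⟩ := exists_stftFun_matrixWigner A
  ext z
  rw [h _ _ (integrable_toFunction _) (integrable_toFunction _), h _ _ φ.integrable ψ.integrable,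
    sesqForm_congr_ae (θ z) (toFunction_ofSchwartz φ) (toFunction_ofSchwartz ψ)]

theorem integrable_stftFun_mul_conj (g f : feichtinger (Fin d)) :
    Integrable (fun q : (Euc (Fin d) × Euc (Fin d)) × (Euc (Fin d) × Euc (Fin d)) =>
      stftFun (toFunction g) q.1 * (starRingEnd ℂ) (stftFun (toFunction f) q.2))
      (volume.prod volume) :=
  (integrable_stftFun_feichtinger g).mul_prod (integrable_conj (integrable_stftFun_feichtinger f))

theorem stftFun_matrixWigner (A : Matrix.GeneralLinearGroup (Fin d ⊕ Fin d) ℝ)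
    (g f : feichtinger (Fin d)) (z : PhaseSpace d × PhaseSpace d) :
    stftFun (matrixWigner A (toFunction g) (toFunction f)) z =
      ∫ q : (Euc (Fin d) × Euc (Fin d)) × (Euc (Fin d) × Euc (Fin d)),
        stftFun (toFunction g) q.1 * (starRingEnd ℂ) (stftFun (toFunction f) q.2) *
          wignerKernel A q z ∂(volume.prod volume) := by
  obtain ⟨c, θ, hθ, hb, h⟩ := exists_stftFun_matrixWigner A
  obtain ⟨C, hC⟩ := hb z
  obtain ⟨B, hB⟩ := exists_norm_wignerKernel_le A
  have hI : Integrable (fun q : (Euc (Fin d) × Euc (Fin d)) × (Euc (Fin d) × Euc (Fin d)) =>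
      stftFun (toFunction g) q.1 * (starRingEnd ℂ) (stftFun (toFunction f) q.2) *
        wignerKernel A q z) (volume.prod volume) :=
    (integrable_stftFun_mul_conj g f).mul_bdd
      ((continuous_wignerKernel A).comp (Continuous.prodMk_left z)).aestronglyMeasurable
      (Filter.Eventually.of_forall fun q => hB q z)
  -- On Gaussian shifts the anonymous c and θ must return the Wigner kernel, so nothing unspecified
  -- survives the expansion.
  have hk (w w' : Euc (Fin d) × Euc (Fin d)) : c * sesqForm (θ z)
      (timeFreqShift w (gaussian (Fin d))) (timeFreqShift w' (gaussian (Fin d))) =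
      wignerKernel A (w, w') z := by
    rw [← h _ _ (SchwartzMap.integrable _) (SchwartzMap.integrable _), wignerKernel,
      ← matrixWigner_timeFreqShift_gaussian]
  rw [integral_prod _ hI, h _ _ (integrable_toFunction g) (integrable_toFunction f),
    sesqForm_toFunction_left (hθ z) hC g (integrable_toFunction f), ← integral_const_mul]
  refine integral_congr_ae (Filter.Eventually.of_forall fun w => ?_)
  simp only []
  rw [sesqForm_toFunction_right (hθ z) hC f (SchwartzMap.integrable _), ← integral_const_mul,
    ← integral_const_mul]
  refine integral_congr_ae (Filter.Eventually.of_forall fun w' => ?_)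
  simp only [← hk]
  ring

end

/-! ### Operator values, coefficients, and comparison of symbols -/

section

/-! ### Duality with elements of `M^∞` -/

theorem exists_ae_norm_stft_le {ι : Type} [Fintype ι] (u : modulationSpace ι ⊤) :
    ∃ C : ℝ, 0 ≤ C ∧ ∀ᵐ z, ‖stft (u : 𝓢'(Euc ι, ℂ)) z‖ ≤ C := by
  have hu : MemLp (stft (u : 𝓢'(Euc ι, ℂ))) ⊤ volume := u.2
  have hfin : eLpNormEssSup (stft (u : 𝓢'(Euc ι, ℂ))) volume ≠ ⊤ := by
    rw [← eLpNorm_exponent_top]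
    exact hu.2.ne
  refine ⟨(eLpNormEssSup (stft (u : 𝓢'(Euc ι, ℂ))) volume).toReal, ENNReal.toReal_nonneg, ?_⟩
  filter_upwards [ae_le_eLpNormEssSup (f := stft (u : 𝓢'(Euc ι, ℂ))) (μ := volume)] with z hz
  rw [← toReal_enorm]
  exact ENNReal.toReal_mono hfin hz

theorem continuous_conjSchwartz {V : Type} [NormedAddCommGroup V] [InnerProductSpace ℝ V] :
    Continuous (conjSchwartz : 𝓢(V, ℂ) → 𝓢(V, ℂ)) :=
  (SchwartzMap.postcompCLM (𝕜 := ℝ) (E := V) (Complex.conjCLE : ℂ →L[ℝ] ℂ)).continuous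

theorem duality_ofSchwartz {ι : Type} [Fintype ι] (u : modulationSpace ι ⊤) (φ : 𝓢(Euc ι, ℂ)) :
    duality u (toFunction (ofSchwartz φ)) = (u : 𝓢'(Euc ι, ℂ)) (conjSchwartz φ) := by
  rw [duality, stftFun_ofSchwartz, (apply_conjSchwartz_eq_integral _ _).2]

/-- Schwartz functions lie in M¹, and on them the duality is the action of the distribution on the
conjugate. -/
theorem eq_of_duality_eq {ι : Type} [Fintype ι] {u v : modulationSpace ι ⊤}
    (h : ∀ g : feichtinger ι, duality u (toFunction g) = duality v (toFunction g)) : u = v := by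
  ext φ
  have := h (ofSchwartz (conjSchwartz φ))
  rwa [duality_ofSchwartz, duality_ofSchwartz, conjSchwartz_conjSchwartz] at this

variable {d : ℕ}

/-- `⟨σ, B_A (π(w) γ, π(w') γ)⟩`, as a function of `(w, w')`. -/
def wignerCoeff (A : Matrix.GeneralLinearGroup (Fin d ⊕ Fin d) ℝ) (σ : 𝓢'(PhaseSpace d, ℂ))
    (q : (Euc (Fin d) × Euc (Fin d)) × (Euc (Fin d) × Euc (Fin d))) : ℂ :=
  σ (conjSchwartz (wignerCLM A (timeFreqShift (tensorPhase q) (gaussian (Fin d ⊕ Fin d)))))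

theorem continuous_wignerCoeff (A : Matrix.GeneralLinearGroup (Fin d ⊕ Fin d) ℝ)
    (σ : 𝓢'(PhaseSpace d, ℂ)) : Continuous (wignerCoeff A σ) := by
  have hσ : Continuous σ := by fun_prop
  exact hσ.comp (continuous_conjSchwartz.comp ((wignerCLM A).continuous.comp
    ((continuous_timeFreqShift _).comp continuous_tensorPhase)))

theorem wignerCoeff_eq_integral (A : Matrix.GeneralLinearGroup (Fin d ⊕ Fin d) ℝ)
    (σ : 𝓢'(PhaseSpace d, ℂ))
    (q : (Euc (Fin d) × Euc (Fin d)) × (Euc (Fin d) × Euc (Fin d))) :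
    wignerCoeff A σ q = ∫ z, stft σ z * (starRingEnd ℂ) (wignerKernel A q z) :=
  (apply_conjSchwartz_eq_integral σ _).2

/-- L^∞–L¹ duality: V_γ σ is essentially bounded and the Wigner kernels share one L¹ norm. -/
theorem exists_norm_wignerCoeff_le (A : Matrix.GeneralLinearGroup (Fin d ⊕ Fin d) ℝ)
    (σ : modulationSpace (Fin d ⊕ Fin d) ⊤) :
    ∃ C : ℝ, 0 ≤ C ∧ ∀ q, ‖wignerCoeff A (σ : 𝓢'(PhaseSpace d, ℂ)) q‖ ≤ C := by
  obtain ⟨C, hC0, hC⟩ := exists_ae_norm_stft_le σ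
  obtain ⟨B, hB⟩ := exists_integral_norm_wignerKernel_eq A
  have hB0 : 0 ≤ B := (integral_nonneg fun _ => norm_nonneg _).trans_eq (hB 0)
  refine ⟨C * B, by positivity, fun q => ?_⟩
  rw [wignerCoeff_eq_integral, ← hB q, ← integral_const_mul]
  refine norm_integral_le_of_norm_le ((integrable_wignerKernel A q).norm.const_mul C) ?_
  filter_upwards [hC] with z hz
  rw [norm_mul, RCLike.norm_conj]
  gcongr

/-- By Fubini from the expansion of B_A(g, f). The pair (A, σ) enters only through its coefficients.
-/
theorem duality_matrixWigner (A : Matrix.GeneralLinearGroup (Fin d ⊕ Fin d) ℝ)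
    (σ : modulationSpace (Fin d ⊕ Fin d) ⊤) (g f : feichtinger (Fin d)) :
    duality σ (matrixWigner A (toFunction g) (toFunction f)) =
      ∫ q : (Euc (Fin d) × Euc (Fin d)) × (Euc (Fin d) × Euc (Fin d)),
        (starRingEnd ℂ) (stftFun (toFunction g) q.1) * stftFun (toFunction f) q.2 *
          wignerCoeff A (σ : 𝓢'(PhaseSpace d, ℂ)) q ∂(volume.prod volume) := by
  obtain ⟨C, hC0, hC⟩ := exists_ae_norm_stft_le σ
  obtain ⟨B, hB⟩ := exists_integral_norm_wignerKernel_eq A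
  have hs := (continuous_stft (σ : 𝓢'(PhaseSpace d, ℂ))).aestronglyMeasurable (μ := volume)
  have ha : Integrable (fun q : (Euc (Fin d) × Euc (Fin d)) × (Euc (Fin d) × Euc (Fin d)) =>
      (starRingEnd ℂ) (stftFun (toFunction g) q.1) * stftFun (toFunction f) q.2)
      (volume.prod volume) :=
    (integrable_conj (integrable_stftFun_feichtinger g)).mul_prod (integrable_stftFun_feichtinger f)
  have hk (q : (Euc (Fin d) × Euc (Fin d)) × (Euc (Fin d) × Euc (Fin d))) :
      Integrable fun z => stft (σ : 𝓢'(PhaseSpace d, ℂ)) z *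
        (starRingEnd ℂ) (wignerKernel A q z) :=
    (integrable_conj (integrable_wignerKernel A q)).bdd_mul hs hC
  have hI := integrable_mul_kernel (C := C * B) ha
    (ν := (volume : Measure (PhaseSpace d × PhaseSpace d)))
    (k := fun q z => stft (σ : 𝓢'(PhaseSpace d, ℂ)) z * (starRingEnd ℂ) (wignerKernel A q z))
    (hs.comp_snd.mul (Complex.continuous_conj.comp
      (continuous_wignerKernel A)).aestronglyMeasurable) hk fun q => by
      rw [← hB q, ← integral_const_mul]
      refine integral_mono_ae (hk q).norm ((integrable_wignerKernel A q).norm.const_mul C) ?_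
      filter_upwards [hC] with z hz
      rw [norm_mul, RCLike.norm_conj]
      gcongr
  have hswap := integral_integral_swap
    (f := fun (q : (Euc (Fin d) × Euc (Fin d)) × (Euc (Fin d) × Euc (Fin d)))
      (z : PhaseSpace d × PhaseSpace d) =>
      (starRingEnd ℂ) (stftFun (toFunction g) q.1) * stftFun (toFunction f) q.2 *
        (stft (σ : 𝓢'(PhaseSpace d, ℂ)) z * (starRingEnd ℂ) (wignerKernel A q z))) hI
  simp_rw [integral_const_mul, ← wignerCoeff_eq_integral] at hswap
  rw [hswap, duality]
  refine integral_congr_ae (Filter.Eventually.of_forall fun z => ?_)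
  simp only []
  rw [stftFun_matrixWigner, ← integral_conj, ← integral_const_mul]
  refine integral_congr_ae (Filter.Eventually.of_forall fun q => ?_)
  simp only [map_mul, Complex.conj_conj]
  ring

theorem duality_matrixWigner_ofSchwartz (A : Matrix.GeneralLinearGroup (Fin d ⊕ Fin d) ℝ)
    (σ : modulationSpace (Fin d ⊕ Fin d) ⊤)
    (q : (Euc (Fin d) × Euc (Fin d)) × (Euc (Fin d) × Euc (Fin d))) :
    duality σ (matrixWigner A
      (toFunction (ofSchwartz (timeFreqShift q.1 (gaussian (Fin d)))))
      (toFunction (ofSchwartz (timeFreqShift q.2 (gaussian (Fin d)))))) =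
      wignerCoeff A (σ : 𝓢'(PhaseSpace d, ℂ)) q := by
  rw [duality, stftFun_matrixWigner_ofSchwartz, matrixWigner_timeFreqShift_gaussian,
    wignerCoeff_eq_integral]
  rfl

/-! ### Existence and uniqueness of the operator values -/

theorem exists_isOpValue (A : Matrix.GeneralLinearGroup (Fin d ⊕ Fin d) ℝ)
    (σ : modulationSpace (Fin d ⊕ Fin d) ⊤) (f : feichtinger (Fin d)) :
    ∃ u, IsOpValue A σ f u := by
  obtain ⟨C, hC0, hC⟩ := exists_norm_wignerCoeff_le A σ
  have hf := integrable_stftFun_feichtinger f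
  -- Integrating w' out of `duality_matrixWigner` leaves ∫ E conj (V_γ g), which is the duality with
  -- V_γ^* E.
  let E : Euc (Fin d) × Euc (Fin d) → ℂ := fun w =>
    ∫ w', stftFun (toFunction f) w' * wignerCoeff A (σ : 𝓢'(PhaseSpace d, ℂ)) (w, w')
  have hE : AEStronglyMeasurable E :=
    (hf.aestronglyMeasurable.comp_snd.mul
      (continuous_wignerCoeff A _).aestronglyMeasurable).integral_prod_right'
  have hb (w : Euc (Fin d) × Euc (Fin d)) :
      ‖E w‖ ≤ ∫ w', ‖stftFun (toFunction f) w'‖ * C := by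
    refine norm_integral_le_of_norm_le (hf.norm.mul_const C)
      (Filter.Eventually.of_forall fun w' => ?_)
    rw [norm_mul]
    exact mul_le_mul_of_nonneg_left (hC _) (norm_nonneg _)
  refine ⟨⟨adjointStft E _ hE hb, mem_modulationSpace_top (norm_stft_adjointStft_le hE hb)⟩,
    fun g => ?_⟩
  rw [duality_adjointStft hE hb _ rfl g, duality_matrixWigner]
  have hI : Integrable (fun q : (Euc (Fin d) × Euc (Fin d)) × (Euc (Fin d) × Euc (Fin d)) =>
      (starRingEnd ℂ) (stftFun (toFunction g) q.1) * stftFun (toFunction f) q.2 *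
        wignerCoeff A (σ : 𝓢'(PhaseSpace d, ℂ)) q) (volume.prod volume) :=
    ((integrable_conj (integrable_stftFun_feichtinger g)).mul_prod hf).mul_bdd
      (continuous_wignerCoeff A _).aestronglyMeasurable (Filter.Eventually.of_forall hC)
  rw [integral_prod _ hI]
  refine integral_congr_ae (Filter.Eventually.of_forall fun w => ?_)
  simp only [E]
  rw [mul_comm, ← integral_const_mul]
  simp_rw [mul_assoc]

theorem existsUnique_isOpValue (A : Matrix.GeneralLinearGroup (Fin d ⊕ Fin d) ℝ)
    (σ : modulationSpace (Fin d ⊕ Fin d) ⊤) (f : feichtinger (Fin d)) :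
    ∃! u, IsOpValue A σ f u := by
  obtain ⟨u, hu⟩ := exists_isOpValue A σ f
  exact ⟨u, hu, fun v hv => eq_of_duality_eq fun g => (hv g).trans (hu g).symm⟩

/-- Testing with f and g both Gaussian shifts recovers each coefficient; conversely the coefficients
determine every pairing. -/
theorem op_eq_op_iff (A B : Matrix.GeneralLinearGroup (Fin d ⊕ Fin d) ℝ)
    (σ ρ : modulationSpace (Fin d ⊕ Fin d) ⊤) : op A σ = op B ρ ↔
      wignerCoeff A (σ : 𝓢'(PhaseSpace d, ℂ)) = wignerCoeff B (ρ : 𝓢'(PhaseSpace d, ℂ)) := by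
  constructor
  · intro h
    ext q
    rw [← duality_matrixWigner_ofSchwartz, ← duality_matrixWigner_ofSchwartz]
    let f := ofSchwartz (timeFreqShift q.2 (gaussian (Fin d)))
    have h1 : IsOpValue A σ f (op A σ f) := Classical.epsilon_spec (exists_isOpValue A σ f)
    have h2 : IsOpValue B ρ f (op B ρ f) := Classical.epsilon_spec (exists_isOpValue B ρ f)
    rw [← h] at h2
    exact (h1 _).symm.trans (h2 _)
  · intro h
    -- The defining conditions coincide as predicates, so the chosen values do too.
    have h1 (f : feichtinger (Fin d)) : IsOpValue A σ f = IsOpValue B ρ f := by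
      ext u
      simp only [IsOpValue, duality_matrixWigner, h]
    ext1 f
    rw [op, op, h1]

/-! ### Comparison of the symbols -/

/-- The duality conjugates its second argument, which is why F₂⁻¹ and not F₂ appears in
`wignerPullback`. -/
theorem conjSchwartz_partialFourierCLM (F : 𝓢(PhaseSpace d, ℂ)) :
    conjSchwartz (partialFourierCLM d F) = partialFourierInvCLM d (conjSchwartz F) := by
  ext z
  rw [conjSchwartz_apply, partialFourierCLM_apply, partialFourierInvCLM_apply, Real.fourier_eq,
    Real.fourierInv_eq, ← integral_conj]
  refine integral_congr_ae (Filter.Eventually.of_forall fun y => ?_)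
  simp only [Circle.smul_def, smul_eq_mul, map_mul, conj_fourierChar, neg_neg, conjSchwartz_apply]

/-- The distribution `Φ ↦ σ (F₂⁻¹ (Φ ∘ A))`. -/
def wignerPullback (A : Matrix.GeneralLinearGroup (Fin d ⊕ Fin d) ℝ)
    (σ : 𝓢'(PhaseSpace d, ℂ)) : 𝓢'(PhaseSpace d, ℂ) :=
  PointwiseConvergenceCLM.precomp ℂ ((partialFourierInvCLM d).comp
    (SchwartzMap.compCLMOfContinuousLinearEquiv ℂ (glEquiv A))) σ

theorem wignerPullback_apply (A : Matrix.GeneralLinearGroup (Fin d ⊕ Fin d) ℝ)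
    (σ : 𝓢'(PhaseSpace d, ℂ)) (F : 𝓢(PhaseSpace d, ℂ)) : wignerPullback A σ F =
      σ (partialFourierInvCLM d (SchwartzMap.compCLMOfContinuousLinearEquiv ℂ (glEquiv A) F)) :=
  rfl

theorem stft_wignerPullback (A : Matrix.GeneralLinearGroup (Fin d ⊕ Fin d) ℝ)
    (σ : 𝓢'(PhaseSpace d, ℂ))
    (q : (Euc (Fin d) × Euc (Fin d)) × (Euc (Fin d) × Euc (Fin d))) :
    stft (wignerPullback A σ) (tensorPhase q) = wignerCoeff A σ q := by
  rw [stft, wignerPullback_apply, wignerCoeff, wignerCLM, ContinuousLinearMap.comp_apply,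
    conjSchwartz_partialFourierCLM]
  rfl

/-- The coefficients are the transform of the pullback reparametrized by `tensorPhase`, which is
onto, and the transform is injective. -/
theorem wignerCoeff_eq_iff (A B : Matrix.GeneralLinearGroup (Fin d ⊕ Fin d) ℝ)
    (σ ρ : 𝓢'(PhaseSpace d, ℂ)) :
    wignerCoeff A σ = wignerCoeff B ρ ↔ wignerPullback A σ = wignerPullback B ρ := by
  constructor
  · intro h
    refine stft_injective (funext fun z => ?_)
    obtain ⟨q, rfl⟩ := surjective_tensorPhase z
    rw [stft_wignerPullback, stft_wignerPullback, h]
  · intro h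
    ext q
    rw [← stft_wignerPullback, ← stft_wignerPullback, h]

theorem glEquiv_mul {ι : Type} [Fintype ι] [DecidableEq ι]
    (A B : Matrix.GeneralLinearGroup ι ℝ) (z : Euc ι) :
    glEquiv (A * B) z = glEquiv A (glEquiv B z) := by
  rw [glEquiv_apply, glEquiv_apply, glEquiv_apply, Units.val_mul, ← Matrix.mulVec_mulVec]

theorem compCLM_glEquiv_mul {ι : Type} [Fintype ι] [DecidableEq ι]
    (A B : Matrix.GeneralLinearGroup ι ℝ) (F : 𝓢(Euc ι, ℂ)) :
    SchwartzMap.compCLMOfContinuousLinearEquiv ℂ (glEquiv B)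
      (SchwartzMap.compCLMOfContinuousLinearEquiv ℂ (glEquiv A) F) =
      SchwartzMap.compCLMOfContinuousLinearEquiv ℂ (glEquiv (A * B)) F := by
  ext z
  simp only [SchwartzMap.compCLMOfContinuousLinearEquiv_apply, Function.comp_apply, glEquiv_mul]

theorem compCLM_glEquiv_one {ι : Type} [Fintype ι] [DecidableEq ι] (F : 𝓢(Euc ι, ℂ)) :
    SchwartzMap.compCLMOfContinuousLinearEquiv ℂ
      (glEquiv (1 : Matrix.GeneralLinearGroup ι ℝ)) F = F := by
  ext z
  simp only [SchwartzMap.compCLMOfContinuousLinearEquiv_apply, Function.comp_apply, glEquiv_apply,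
    Units.val_one, Matrix.one_mulVec]

/-- `coordTransformDist (B⁻¹ * A)` contributes |det (B⁻¹A)|⁻¹ = |det B| / |det A|, which the
prefactor cancels. -/
theorem smul_partialFourierDist_apply (A B : Matrix.GeneralLinearGroup (Fin d ⊕ Fin d) ℝ)
    (ρ : 𝓢'(PhaseSpace d, ℂ)) (F : 𝓢(PhaseSpace d, ℂ)) :
    (((|(A : Matrix (Fin d ⊕ Fin d) (Fin d ⊕ Fin d) ℝ).det| /
        |(B : Matrix (Fin d ⊕ Fin d) (Fin d ⊕ Fin d) ℝ).det| : ℝ) : ℂ) •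
      partialFourierDist d (coordTransformDist (B⁻¹ * A) (partialFourierInvDist d ρ))) F =
    ρ (partialFourierInvCLM d (SchwartzMap.compCLMOfContinuousLinearEquiv ℂ (glEquiv (A⁻¹ * B))
      (partialFourierCLM d F))) := by
  have e : (((|(A : Matrix (Fin d ⊕ Fin d) (Fin d ⊕ Fin d) ℝ).det| /
        |(B : Matrix (Fin d ⊕ Fin d) (Fin d ⊕ Fin d) ℝ).det| : ℝ) : ℂ) •
      partialFourierDist d (coordTransformDist (B⁻¹ * A) (partialFourierInvDist d ρ))) F =
      ((|(A : Matrix (Fin d ⊕ Fin d) (Fin d ⊕ Fin d) ℝ).det| /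
        |(B : Matrix (Fin d ⊕ Fin d) (Fin d ⊕ Fin d) ℝ).det| : ℝ) : ℂ) *
      (((|((B⁻¹ * A : Matrix.GeneralLinearGroup (Fin d ⊕ Fin d) ℝ) :
        Matrix (Fin d ⊕ Fin d) (Fin d ⊕ Fin d) ℝ).det|⁻¹ : ℝ) : ℂ) *
      ρ (partialFourierInvCLM d (SchwartzMap.compCLMOfContinuousLinearEquiv ℂ
        (glEquiv (B⁻¹ * A)⁻¹) (partialFourierCLM d F)))) := rfl
  have hA : (A : Matrix (Fin d ⊕ Fin d) (Fin d ⊕ Fin d) ℝ).det ≠ 0 :=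
    A.det_ne_zero
  have hB : (B : Matrix (Fin d ⊕ Fin d) (Fin d ⊕ Fin d) ℝ).det ≠ 0 :=
    B.det_ne_zero
  have hdet : (A : Matrix (Fin d ⊕ Fin d) (Fin d ⊕ Fin d) ℝ).det =
      (B : Matrix (Fin d ⊕ Fin d) (Fin d ⊕ Fin d) ℝ).det *
        ((B⁻¹ * A : Matrix.GeneralLinearGroup (Fin d ⊕ Fin d) ℝ) :
          Matrix (Fin d ⊕ Fin d) (Fin d ⊕ Fin d) ℝ).det := by
    rw [← Matrix.det_mul, ← Units.val_mul, mul_inv_cancel_left]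
  have hr : |(A : Matrix (Fin d ⊕ Fin d) (Fin d ⊕ Fin d) ℝ).det| /
      |(B : Matrix (Fin d ⊕ Fin d) (Fin d ⊕ Fin d) ℝ).det| *
      |((B⁻¹ * A : Matrix.GeneralLinearGroup (Fin d ⊕ Fin d) ℝ) :
        Matrix (Fin d ⊕ Fin d) (Fin d ⊕ Fin d) ℝ).det|⁻¹ = 1 := by
    have h1 := abs_ne_zero.2 hA
    have h2 := abs_ne_zero.2 hB
    rw [hdet, abs_mul] at h1 ⊢
    have h3 := right_ne_zero_of_mul h1
    rw [mul_div_cancel_left₀ _ h2, mul_inv_cancel₀ h3]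
  rw [e, ← mul_assoc, ← Complex.ofReal_mul, hr, Complex.ofReal_one, one_mul, mul_inv_rev, inv_inv]

/-- The map Φ ↦ F₂⁻¹(Φ ∘ A) is a bijection of the Schwartz space with inverse F ↦ (F₂ F) ∘ A⁻¹.
Inserting the latter for Φ turns the equality of pullbacks into the formula for σ. -/
theorem wignerPullback_eq_iff (A B : Matrix.GeneralLinearGroup (Fin d ⊕ Fin d) ℝ)
    (σ ρ : 𝓢'(PhaseSpace d, ℂ)) : wignerPullback A σ = wignerPullback B ρ ↔
      σ = ((|(A : Matrix (Fin d ⊕ Fin d) (Fin d ⊕ Fin d) ℝ).det| /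
            |(B : Matrix (Fin d ⊕ Fin d) (Fin d ⊕ Fin d) ℝ).det| : ℝ) : ℂ) •
          partialFourierDist d (coordTransformDist (B⁻¹ * A) (partialFourierInvDist d ρ)) := by
  constructor
  · intro h
    ext F
    rw [smul_partialFourierDist_apply, ← compCLM_glEquiv_mul, ← wignerPullback_apply, ← h,
      wignerPullback_apply, compCLM_glEquiv_mul, inv_mul_cancel, compCLM_glEquiv_one,
      partialFourierInvCLM_partialFourierCLM]
  · intro h
    ext F
    rw [wignerPullback_apply, wignerPullback_apply, h, smul_partialFourierDist_apply,
      partialFourierCLM_partialFourierInvCLM, compCLM_glEquiv_mul, mul_inv_cancel_left]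

end

end MatrixWigner

end

theorem mainTheorem3 (d : ℕ) (A B : Matrix.GeneralLinearGroup (Fin d ⊕ Fin d) ℝ)
    (σ ρ : MatrixWigner.modulationSpace (Fin d ⊕ Fin d) ⊤) :
    (∀ f : MatrixWigner.feichtinger (Fin d), ∃! u, MatrixWigner.IsOpValue A σ f u) ∧
    (∀ f : MatrixWigner.feichtinger (Fin d), ∃! u, MatrixWigner.IsOpValue B ρ f u) ∧
    (MatrixWigner.op A σ = MatrixWigner.op B ρ ↔
      (σ : 𝓢'(MatrixWigner.PhaseSpace d, ℂ)) =
        ((|(A : Matrix (Fin d ⊕ Fin d) (Fin d ⊕ Fin d) ℝ).det| /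
            |(B : Matrix (Fin d ⊕ Fin d) (Fin d ⊕ Fin d) ℝ).det| : ℝ) : ℂ) •
          MatrixWigner.partialFourierDist d
            (MatrixWigner.coordTransformDist (B⁻¹ * A)
              (MatrixWigner.partialFourierInvDist d ρ))) :=
  ⟨MatrixWigner.existsUnique_isOpValue A σ, MatrixWigner.existsUnique_isOpValue B ρ,
    (MatrixWigner.op_eq_op_iff A B σ ρ).trans
      ((MatrixWigner.wignerCoeff_eq_iff A B _ _).trans
        (MatrixWigner.wignerPullback_eq_iff A B _ _))⟩
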